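/- **Setting.** Let $I=[0,1]$. A map $\tau:I\to I$ is *piecewise monotonic with associated partition* $C=\{a_0,\dots,a_n\}$, $0=a_0<a_1<\dots<a_n=1$, if $\tau$ is continuous and strictly monotonic on each $(a_{i-1},a_i)$; let $\tau_i$ be the continuous extension of $\tau|_{(a_{i-1},a_i)}$ to $[a_{i-1},a_i]$. (The partition need not be maximal, and the values of $\tau$ on $C$ are arbitrary.) For $x\in I$ let $\widehat\tau(x)$ be the set of left and right limits of $\tau$ at $x$ (only the right limit at $0$, only the left limit at $1$), and put $\widehat\tau(A)=\bigcup_{x\in A}\widehat\tau(x)$, $\widehat\tau^{-1}(A)=\{x:\widehat\tau(x)\cap A\neq\emptyset\}$ and $\mathrm{orbit}(A)=\bigcup_{k\ge0}\widehat\tau^{\,k}(A)$. Let $I_1$ be the smallest subset of $I$ containing $C$ and closed under $\widehat\tau$ and $\widehat\tau^{-1}$. Let $X$ be the totally ordered set, with the order topology, obtained from $I$ by replacing each $x\in I_1\setminus\{0,1\}$ by two points $x^-<x^+$; for the other points of $I$ write $x^-=x^+=x$. The local homeomorphism $\sigma:X\to X$ associated with $\tau$ is given on the clopen order interval $[a_{i-1}^+,a_i^-]$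 by $\sigma(x^\pm)=\tau_i(x)^\pm$ if $\tau_i$ is increasing and $\sigma(x^\pm)=\tau_i(x)^\mp$ if $\tau_i$ is decreasing, where the endpoint $0$ of $X$ is treated as $0^+$ and the endpoint $1$ as $1^-$. Let $\mathcal L:C(X,\mathbb Z)\to C(X,\mathbb Z)$ be the transfer map $(\mathcal Lf)(x)=\sum_{\sigma(y)=x}f(y)$. The group $DG(\tau)$ is the quotient of $C(X,\mathbb Z)$ by the relation $f\sim g$ iff $\mathcal L^kf=\mathcal L^kg$ for some $k\ge0$. (If $C$ is not the maximal partition, this group also depends on $C$.) If $\tau$ is surjective in the sense that $\widehat\tau(I)=I$, then $\mathcal L_*[f]=[\mathcal Lf]$ is an automorphism of $DG(\tau)$, and $DG(\tau)$ is a $\mathbb Z[t,t^{-1}]$-module on which $t$ acts as $\mathcal L_*$. The map $\tau$ is *essentially bijective* if $\widehat\tau(I)=I$ and there are no disjoint nondegenerate intervals $J,J'\subset I$ with $\tau(J)=\tau(J')$. **Statement.** Let $\tau:I\to I$ be piecewise monotonic with associated partition $C=\{a_0,\dots,a_n\}$. 1. If $\tau$ is essentially bijective and $\mathrm{orbit}(\widehat\tau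 C)\cap C\subset\{0,1\}$, then the (unordered) $\mathbb Z[t,t^{-1}]$-module $DG(\tau)$ is isomorphic to $\mathbb Z[t,t^{-1}]^{\,n-1}\oplus\mathbb Z$, where $\mathbb Z[t,t^{-1}]$ acts on the first summand in the usual way and $t$ acts trivially on the second. 2. Suppose that $\tau$ is a generalized interval exchange map: $\tau$ is increasing on each $(a_{i-1},a_i)$, restricts to a bijection of $[0,1)$ onto itself, is right continuous at every point of $[0,1)$, and is left continuous at $1$. Suppose that the points $a_1,\dots,a_{n-1}$ have infinite and disjoint $\tau$-orbits, i.e. $\tau^k(a_i)=\tau^l(a_j)$ with $1\le i,j\le n-1$ and $k,l\ge0$ implies $i=j$ and $k=l$. Then $\tau$ is essentially bijective, $DG(\tau)=C(X,\mathbb Z)$ (that is, $f\mapsto[f]$ is a bijection of $C(X,\mathbb Z)$ onto $DG(\tau)$), and $DG(\tau)$ is isomorphic as a $\mathbb Z[t,t^{-1}]$-module to $\mathbb Z[t,t^{-1}]^{\,n-1}\oplus\mathbb Z$ as in 1. -/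

import Mathlib

open Set Filter Topology
open scoped LaurentPolynomial

/-- A piecewise homeomorphism: a continuous open map `σ : X → X` such that `X` has a finite partition
into clopen sets, on each of which `σ` is injective (hence a homeomorphism onto its image). The images
of these sets are clopen; for compact Hausdorff `X` this last requirement is automatic. -/
structure IsPiecewiseHomeo {X : Type*} [TopologicalSpace X] (σ : X → X) : Prop where
  continuous : Continuous σ
  isOpenMap : IsOpenMap σ
  exists_partition : ∃ (n : ℕ) (P : Fin n → Set X), (∀ i, IsClopen (P i)) ∧
    (∀ i j, i ≠ j → Disjoint (P i) (P j)) ∧ (⋃ i, P i) = univ ∧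
    ∀ i, InjOn σ (P i) ∧ IsClopen (σ '' P i)

section Transfer

variable {X : Type*} [TopologicalSpace X] {σ : X → X}

lemma IsPiecewiseHomeo.finite_fiber (h : IsPiecewiseHomeo σ) (x : X) : (σ ⁻¹' {x}).Finite := by
  obtain ⟨n, P, -, -, hU, hI⟩ := h.exists_partition
  have : σ ⁻¹' {x} = ⋃ i, (P i ∩ σ ⁻¹' {x}) := by rw [← iUnion_inter, hU, univ_inter]
  rw [this]
  refine finite_iUnion fun i => Set.Subsingleton.finite ?_
  rintro a ⟨ha, ha'⟩ b ⟨hb, hb'⟩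
  exact (hI i).1 ha hb (ha'.trans hb'.symm)

lemma IsPiecewiseHomeo.continuous_transfer (h : IsPiecewiseHomeo σ) (f : C(X, ℤ)) :
    Continuous fun x => ∑ᶠ y ∈ σ ⁻¹' {x}, f y := by
  classical
  obtain ⟨n, P, hP, hD, hU, hI⟩ := h.exists_partition
  have key : (fun x => ∑ᶠ y ∈ σ ⁻¹' {x}, f y) =
      fun x => ∑ i : Fin n, ∑ᶠ y ∈ P i ∩ σ ⁻¹' {x}, f y := by
    funext x
    have e : σ ⁻¹' {x} = ⋃ i, (P i ∩ σ ⁻¹' {x}) := by rw [← iUnion_inter, hU, univ_inter]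
    conv_lhs => rw [e]
    rw [finsum_mem_iUnion, finsum_eq_sum_of_fintype]
    · intro i j hij
      exact (hD i j hij).mono inter_subset_left inter_subset_left
    · exact fun i => (h.finite_fiber x).subset inter_subset_right
  rw [key]
  refine continuous_finsetSum _ fun i _ => ?_
  have val : ∀ y ∈ P i, ∑ᶠ z ∈ P i ∩ σ ⁻¹' {σ y}, f z = f y := by
    intro y hy
    have : P i ∩ σ ⁻¹' {σ y} = {y} := by
      ext z
      simp only [mem_inter_iff, mem_preimage, mem_singleton_iff]
      exact ⟨fun hz => (hI i).1 hz.1 hy hz.2, by rintro rfl; exact ⟨hy, rfl⟩⟩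
    rw [this, finsum_mem_singleton]
  rw [← IsLocallyConstant.iff_continuous, IsLocallyConstant.iff_exists_open]
  intro x
  by_cases hx : x ∈ σ '' P i
  · obtain ⟨y, hy, rfl⟩ := hx
    refine ⟨σ '' (P i ∩ f ⁻¹' {f y}), h.isOpenMap _ ((hP i).isOpen.inter
      ((isOpen_discrete _).preimage f.continuous)), ⟨y, ⟨hy, rfl⟩, rfl⟩, ?_⟩
    rintro _ ⟨z, ⟨hz, hzf⟩, rfl⟩
    rw [val z hz, val y hy]; exact hzf
  · refine ⟨(σ '' P i)ᶜ, (hI i).2.compl.isOpen, hx, fun z hz => ?_⟩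
    have : ∀ w, w ∉ σ '' P i → ∑ᶠ y ∈ P i ∩ σ ⁻¹' {w}, f y = 0 := by
      intro w hw
      have : P i ∩ σ ⁻¹' {w} = ∅ := by
        ext y
        simp only [mem_inter_iff, mem_preimage, mem_singleton_iff, mem_empty_iff_false, iff_false]
        rintro ⟨hy, rfl⟩
        exact hw ⟨y, hy, rfl⟩
      rw [this, finsum_mem_empty]
    rw [this z hz, this x hx]

/-- The transfer map `(L f)(x) = ∑_{σ y = x} f y` on `C(X, ℤ)`. All fibres of `σ` are finite. -/
noncomputable def transfer (h : IsPiecewiseHomeo σ) : C(X, ℤ) →+ C(X, ℤ) where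
  toFun f := ⟨fun x => ∑ᶠ y ∈ σ ⁻¹' {x}, f y, h.continuous_transfer f⟩
  map_zero' := by ext x; simp
  map_add' f g := by ext x; simpa using finsum_mem_add_distrib (h.finite_fiber x)

lemma transfer_surjective (h : IsPiecewiseHomeo σ) (hs : Function.Surjective σ) :
    Function.Surjective (transfer h) := by
  classical
  intro f
  obtain ⟨n, P, hP, hD, hU, hI⟩ := h.exists_partition
  let Q : Fin n → Set X := fun i => P i ∩ σ ⁻¹' (⋂ j : Fin n, if j < i then (σ '' P j)ᶜ else univ)
  have hQ : ∀ i, IsClopen (Q i) := fun i => (hP i).inter <| IsClopen.preimage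
    (isClopen_iInter_of_finite fun j => by
      split_ifs
      · exact (hI j).2.compl
      · exact isClopen_univ) h.continuous
  let E : Set X := ⋃ i, Q i
  have hE : IsClopen E := isClopen_iUnion_of_finite hQ
  have hQmem : ∀ i y, y ∈ Q i ↔ y ∈ P i ∧ ∀ j < i, σ y ∉ σ '' P j := by
    intro i y
    simp only [Q, mem_inter_iff, mem_preimage, mem_iInter]
    refine and_congr_right fun _ => forall_congr' fun j => ?_
    split_ifs with hj <;> simp [hj]
  have hinj : InjOn σ E := by
    intro y hy z hz hyz
    obtain ⟨i, hi⟩ := mem_iUnion.1 hy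
    obtain ⟨j, hj⟩ := mem_iUnion.1 hz
    rw [hQmem] at hi hj
    have : i = j := by
      rcases lt_trichotomy i j with hij | hij | hij
      · exact absurd ⟨y, hi.1, hyz⟩ (hj.2 i hij)
      · exact hij
      · exact absurd ⟨z, hj.1, hyz.symm⟩ (hi.2 j hij)
    subst this
    exact (hI i).1 hi.1 hj.1 hyz
  have hsurj : ∀ x, ∃ y ∈ E, σ y = x := by
    intro x
    have hne : ∃ i, x ∈ σ '' P i := by
      obtain ⟨y, rfl⟩ := hs x
      obtain ⟨i, hi⟩ := mem_iUnion.1 (hU.symm ▸ mem_univ y : y ∈ ⋃ i, P i)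
      exact ⟨i, y, hi, rfl⟩
    obtain ⟨i, hi, hmin⟩ := WellFounded.has_min (wellFounded_lt (α := Fin n))
      {i | x ∈ σ '' P i} hne
    obtain ⟨y, hy, rfl⟩ := hi
    exact ⟨y, mem_iUnion.2 ⟨i, (hQmem i y).2 ⟨hy, fun j hj hj' => hmin j hj' hj⟩⟩, rfl⟩
  have hcont : Continuous (E.indicator fun y => f (σ y)) :=
    Continuous.indicator (by simp [hE.frontier_eq]) (f.continuous.comp h.continuous)
  refine ⟨⟨_, hcont⟩, ?_⟩
  ext x
  obtain ⟨y, hy, rfl⟩ := hsurj x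
  change ∑ᶠ z ∈ σ ⁻¹' {σ y}, E.indicator (fun y => f (σ y)) z = _
  have : ∑ᶠ z ∈ σ ⁻¹' {σ y}, E.indicator (fun y => f (σ y)) z =
      ∑ᶠ z ∈ ({y} : Set X), E.indicator (fun y => f (σ y)) z := by
    refine finsum_mem_inter_support_eq' _ _ _ fun z hz => ?_
    have hzE : z ∈ E := mem_of_indicator_ne_zero hz
    simp only [mem_preimage, mem_singleton_iff]
    exact ⟨fun e => hinj hzE hy e, fun e => by rw [e]⟩
  rw [this, finsum_mem_singleton, indicator_of_mem hy]

end Transfer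

section DimensionGroup

variable {M : Type*} [AddCommGroup M]

/-- The functions `f` with `Lᵏ f = 0` for some `k ≥ 0`. Thus `f - g` is in this subgroup iff
`Lᵏ f = Lᵏ g` for some `k`. -/
def eventualKernel (L : M →+ M) : AddSubgroup M where
  carrier := {f | ∃ n : ℕ, L^[n] f = 0}
  zero_mem' := ⟨0, rfl⟩
  add_mem' := by
    rintro f g ⟨m, hm⟩ ⟨n, hn⟩
    refine ⟨m + n, ?_⟩
    rw [iterate_map_add, add_comm m n, Function.iterate_add_apply, hm, add_comm n m,
      Function.iterate_add_apply, hn, iterate_map_zero, iterate_map_zero, add_zero]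
  neg_mem' := by
    rintro f ⟨n, hn⟩
    exact ⟨n, by rw [iterate_map_neg, hn, neg_zero]⟩

/-- The quotient of `M` by the relation: `f ∼ g` iff `Lᵏ f = Lᵏ g` for some `k ≥ 0`. -/
abbrev DimensionGroup (L : M →+ M) : Type _ := M ⧸ eventualKernel L

/-- The map `L_*` given by `L_* [f] = [L f]`. -/
def inducedMap (L : M →+ M) : DimensionGroup L →+ DimensionGroup L :=
  QuotientAddGroup.map _ _ L <| by
    rintro f ⟨n, hn⟩
    exact ⟨n, by rw [← Function.iterate_succ_apply, Function.iterate_succ_apply', hn, map_zero]⟩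

lemma inducedMap_bijective (L : M →+ M) (hL : Function.Surjective L) :
    Function.Bijective (inducedMap L) := by
  constructor
  · rw [injective_iff_map_eq_zero]
    intro x
    induction x using QuotientAddGroup.induction_on with
    | H f =>
      intro h
      obtain ⟨n, hn⟩ := (QuotientAddGroup.eq_zero_iff _).1 h
      exact (QuotientAddGroup.eq_zero_iff _).2 ⟨n + 1, hn⟩
  · intro x
    induction x using QuotientAddGroup.induction_on with
    | H f =>
      obtain ⟨g, rfl⟩ := hL f
      exact ⟨(g : DimensionGroup L), rfl⟩

end DimensionGroup


/-- The disconnection of `[0,1]` at the points of `S`: the unit interval in which each point `x` of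
`S \ {0,1}` is replaced by two points `x⁻ < x⁺`. An element is a point `pt` of the interval together
with a flag; the flag `true` marks the points `x⁺` for `x ∈ S \ {0,1}`, and `false` marks all other
points. The collapse map is `pt`. -/
@[ext]
structure Disconnection (S : Set unitInterval) where
  pt : unitInterval
  right : Bool
  mem : right = true → pt ∈ S ∧ pt ≠ 0 ∧ pt ≠ 1

namespace Disconnection

variable {S : Set unitInterval}

/-- The lexicographic order. -/
noncomputable instance : LinearOrder (Disconnection S) :=
  LinearOrder.lift' (fun p => toLex (p.pt, p.right)) fun p q hpq => by
    have h := Prod.mk.inj (toLex.injective hpq)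
    exact Disconnection.ext h.1 h.2

/-- The order topology. -/
noncomputable instance : TopologicalSpace (Disconnection S) := Preorder.topology _

instance : OrderTopology (Disconnection S) := ⟨rfl⟩

open Classical in
/-- `lift S x true` is `x⁺` and `lift S x false` is `x⁻`; where `x` is not doubled, both are the unique
point above `x`. -/
noncomputable def lift (S : Set unitInterval) (x : unitInterval) (b : Bool) : Disconnection S :=
  if h : x ∈ S ∧ x ≠ 0 ∧ x ≠ 1 then ⟨x, b, fun _ => h⟩ else ⟨x, false, nofun⟩

open Classical in
/-- The side of its base point on which `p` lies: `true` for the points `x⁺` and for the endpoint `0`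
(which is approached from the right only), `false` for the points `x⁻` and for the endpoint `1`. For
the other points, at which the interval is not cut, the value `false` is a convention. -/
noncomputable def side (p : Disconnection S) : Bool := p.right || decide (p.pt = 0)

lemma lt_def (p q : Disconnection S) :
    p < q ↔ p.pt < q.pt ∨ p.pt = q.pt ∧ p.right < q.right :=
  Prod.Lex.toLex_lt_toLex (x := (p.pt, p.right)) (y := (q.pt, q.right))

@[simp] lemma lift_pt (x : unitInterval) (b : Bool) : (lift S x b).pt = x := by
  unfold lift; split_ifs <;> rfl

lemma lift_side (p : Disconnection S) : lift S p.pt p.side = p := by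
  unfold lift
  split_ifs with h
  · ext <;> simp [side, h.2.1]
  · ext
    · rfl
    · cases hr : p.right
      · rfl
      · exact absurd (p.mem hr) h

lemma lift_lt_lift (x y : unitInterval) (b b' : Bool) : lift S x b < lift S y b' ↔
    x < y ∨ x = y ∧ b = false ∧ b' = true ∧ x ∈ S ∧ x ≠ 0 ∧ x ≠ 1 := by
  rw [lt_def, lift_pt, lift_pt]
  refine or_congr_right (and_congr_right ?_)
  rintro rfl
  unfold lift
  split_ifs with h <;> cases b <;> cases b' <;> simp [h]

lemma lift_le_lift (x y : unitInterval) (b b' : Bool) : lift S x b ≤ lift S y b' ↔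
    x < y ∨ x = y ∧ (b = false ∨ b' = true ∨ ¬ (x ∈ S ∧ x ≠ 0 ∧ x ≠ 1)) := by
  rw [← not_lt, lift_lt_lift]
  rcases lt_trichotomy x y with h | rfl | h
  · simp [h, h.not_gt, h.ne']
  · cases b <;> cases b' <;> simp
  · simp [h, h.not_gt, h.ne']

lemma side_zero (p : Disconnection S) (h : p.pt = 0) : p.side = true := by simp [side, h]

lemma side_one (p : Disconnection S) (h : p.pt = 1) : p.side = false := by
  cases hr : p.right
  · simp [side, hr, h]
  · exact absurd h (p.mem hr).2.2

lemma isClopen_Icc {c d : unitInterval} (hc : c ∈ S) (hd : d ∈ S) (hcd : c < d) :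
    IsClopen (Icc (lift S c true) (lift S d false)) := by
  refine ⟨isClosed_Icc, ?_⟩
  have hc1 : c ≠ 1 := fun h => absurd hcd (not_lt.2 (h ▸ unitInterval.le_one'))
  have hd0 : d ≠ 0 := fun h => absurd hcd (not_lt.2 (h ▸ unitInterval.nonneg'))
  rw [← Ici_inter_Iic]
  refine IsOpen.inter ?_ ?_
  · by_cases h0 : c = 0
    · convert isOpen_univ
      refine eq_univ_of_forall fun p => ?_
      rw [mem_Ici, ← lift_side p, lift_le_lift]
      rcases eq_or_lt_of_le (unitInterval.nonneg' : 0 ≤ p.pt) with h | h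
      · right; simp [h0, h]
      · left; rwa [h0]
    · convert isOpen_Ioi (a := lift S c false) using 1
      ext p
      rw [mem_Ici, mem_Ioi, ← lift_side p, lift_le_lift, lift_lt_lift]
      simp [hc, h0, hc1]
  · by_cases h1 : d = 1
    · convert isOpen_univ
      refine eq_univ_of_forall fun p => ?_
      rw [mem_Iic, ← lift_side p, lift_le_lift]
      rcases eq_or_lt_of_le (unitInterval.le_one' : p.pt ≤ 1) with h | h
      · right; simp [h1, h]
      · left; rwa [h1]
    · convert isOpen_Iio (a := lift S d true) using 1
      ext p
      rw [mem_Iic, mem_Iio, ← lift_side p, lift_le_lift, lift_lt_lift]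
      constructor <;> rintro (h | ⟨h, h'⟩) <;> simp_all

section Branch
variable {c d : unitInterval} {g : unitInterval → unitInterval}

lemma mem_Icc_lift {c d : unitInterval} (hc : c ∈ S) (hd : d ∈ S) (hcd : c < d)
    (p : Disconnection S) : p ∈ Icc (lift S c true) (lift S d false) ↔
      (p.side = true ∧ p.pt ∈ Ico c d) ∨ (p.side = false ∧ p.pt ∈ Ioc c d) := by
  have hc1 : c ≠ 1 := fun h => absurd hcd (not_lt.2 (h ▸ unitInterval.le_one'))
  have hd0 : d ≠ 0 := fun h => absurd hcd (not_lt.2 (h ▸ unitInterval.nonneg'))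
  have h0 := side_zero p
  have h1 := side_one p
  have key : p ∈ Icc (lift S c true) (lift S d false) ↔
     lift S c true ≤ lift S p.pt p.side ∧ lift S p.pt p.side ≤ lift S d false := by
    rw [lift_side]; rfl
  rw [key, lift_le_lift, lift_le_lift, mem_Ico, mem_Ioc]
  generalize p.pt = x at *
  cases hb : p.side <;> rw [hb] at h0 h1 <;> grind

lemma strictMonoOn_lift (hc : c ∈ S) (hd : d ∈ S) (hcd : c < d) (hg : StrictMonoOn g (Icc c d))
    (hS : ∀ x ∈ Icc c d, g x ∈ S ↔ x ∈ S) :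
    StrictMonoOn (fun p : Disconnection S => lift S (g p.pt) p.side)
      (Icc (lift S c true) (lift S d false)) := by
  intro p hp q hq hpq
  have h1 : ∀ x : unitInterval, x ≤ 1 := fun x => unitInterval.le_one'
  have h0 : ∀ x : unitInterval, 0 ≤ x := fun x => unitInterval.nonneg'
  rw [mem_Icc_lift hc hd hcd] at hp hq
  rw [← lift_side p, ← lift_side q, lift_lt_lift] at hpq
  simp only [lift_lt_lift]
  have hpI : p.pt ∈ Icc c d := by grind
  have hqI : q.pt ∈ Icc c d := by grind
  rcases hpq with h | ⟨h, hb, hb', hm⟩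
  · exact Or.inl (hg hpI hqI h)
  · right
    have e1 : c < p.pt := by grind
    have e2 : p.pt < d := by grind
    have f1 := hg ⟨le_rfl, hcd.le⟩ hpI e1
    have f2 := hg hpI ⟨hcd.le, le_rfl⟩ e2
    refine ⟨by rw [h], hb, hb', (hS _ hpI).2 hm.1, ((h0 _).trans_lt f1).ne', (f2.trans_le (h1 _)).ne⟩

lemma strictAntiOn_lift (hc : c ∈ S) (hd : d ∈ S) (hcd : c < d) (hg : StrictAntiOn g (Icc c d))
    (hS : ∀ x ∈ Icc c d, g x ∈ S ↔ x ∈ S) :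
    StrictAntiOn (fun p : Disconnection S => lift S (g p.pt) (!p.side))
      (Icc (lift S c true) (lift S d false)) := by
  intro p hp q hq hpq
  have h1 : ∀ x : unitInterval, x ≤ 1 := fun x => unitInterval.le_one'
  have h0 : ∀ x : unitInterval, 0 ≤ x := fun x => unitInterval.nonneg'
  rw [mem_Icc_lift hc hd hcd] at hp hq
  rw [← lift_side p, ← lift_side q, lift_lt_lift] at hpq
  simp only [lift_lt_lift]
  have hpI : p.pt ∈ Icc c d := by grind
  have hqI : q.pt ∈ Icc c d := by grind
  rcases hpq with h | ⟨h, hb, hb', hm⟩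
  · exact Or.inl (hg hpI hqI h)
  · right
    have e1 : c < p.pt := by grind
    have e2 : p.pt < d := by grind
    have f1 := hg ⟨le_rfl, hcd.le⟩ hpI e1
    have f2 := hg hpI ⟨hcd.le, le_rfl⟩ e2
    refine ⟨by rw [h], by simp [hb'], by simp [hb], h ▸ (hS _ hpI).2 hm.1,
      h ▸ ((h0 _).trans_lt f2).ne', h ▸ (f1.trans_le (h1 _)).ne⟩

lemma lift_pt_side {x : unitInterval} {b : Bool} (hx : x ∈ S) (h0 : x = 0 → b = true)
    (h1 : x = 1 → b = false) : (lift S x b).side = b := by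
  unfold lift
  split_ifs with h
  · simp [side, h.2.1]
  · have : x = 0 ∨ x = 1 := by tauto
    rcases this with rfl | rfl
    · simp [side, h0 rfl]
    · simp [side, h1 rfl]

lemma image_lift (b : Bool) (hc : c ∈ S) (hd : d ∈ S) (hcd : c < d)
    (hg : if b then StrictAntiOn g (Icc c d) else StrictMonoOn g (Icc c d))
    (hgc : ContinuousOn g (Icc c d))
    (hS : ∀ x ∈ Icc c d, g x ∈ S ↔ x ∈ S) :
    (fun p : Disconnection S => lift S (g p.pt) (xor b p.side)) ''
      (Icc (lift S c true) (lift S d false)) =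
      Icc (lift S (if b then g d else g c) true) (lift S (if b then g c else g d) false) := by
  have h1 : ∀ x : unitInterval, x ≤ 1 := fun x => unitInterval.le_one'
  have h0 : ∀ x : unitInterval, 0 ≤ x := fun x => unitInterval.nonneg'
  have hcI : c ∈ Icc c d := ⟨le_rfl, hcd.le⟩
  have hdI : d ∈ Icc c d := ⟨hcd.le, le_rfl⟩
  have hlt : (if b then g d else g c) < (if b then g c else g d) := by
    cases b
    · exact hg hcI hdI hcd
    · exact hg hcI hdI hcd
  have hmem : ∀ y, y ∈ Icc (if b then g d else g c) (if b then g c else g d) →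
      ∃ x ∈ Icc c d, g x = y := by
    intro y hy
    cases b
    · exact intermediate_value_Icc hcd.le hgc hy
    · exact intermediate_value_Icc' hcd.le hgc hy
  have hcS := (hS c hcI).2 hc
  have hdS := (hS d hdI).2 hd
  have hcS' : (if b then g d else g c) ∈ S := by split_ifs <;> assumption
  have hdS' : (if b then g c else g d) ∈ S := by split_ifs <;> assumption
  ext q
  rw [mem_Icc_lift hcS' hdS' hlt]
  constructor
  · rintro ⟨p, hp, rfl⟩
    dsimp only
    rw [← mem_Icc_lift hcS' hdS' hlt, mem_Icc, lift_le_lift, lift_le_lift]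
    rw [mem_Icc_lift hc hd hcd] at hp
    have hpI : p.pt ∈ Icc c d := by grind
    cases b <;> simp only [Bool.false_xor, Bool.true_xor, if_true, if_false,
      Bool.false_eq_true] at hg ⊢ <;>
    · rcases hp with ⟨hs, hp⟩ | ⟨hs, hp⟩
      · have e1 := hg hpI hdI hp.2
        have e2 := fun h : c < p.pt => hg hcI hpI h
        have e3 : c = p.pt ∨ c < p.pt := eq_or_lt_of_le hp.1
        rw [hs]
        grind
      · have e1 := hg hcI hpI hp.1
        have e2 := fun h : p.pt < d => hg hpI hdI h
        have e3 : p.pt = d ∨ p.pt < d := eq_or_lt_of_le hp.2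
        rw [hs]
        grind
  · intro hq
    have hqI : q.pt ∈ Icc (if b then g d else g c) (if b then g c else g d) := by grind
    obtain ⟨x, hx, hxy⟩ := hmem _ hqI
    have hne : (xor b q.side = true → x ≠ d) ∧ (xor b q.side = false → x ≠ c) := by
      constructor
      · rintro e rfl
        cases b <;> grind
      · rintro e rfl
        cases b <;> grind
    have hmm : lift S x (xor b q.side) ∈ Icc (lift S c true) (lift S d false) := by
      rw [mem_Icc, lift_le_lift, lift_le_lift]
      grind
    refine ⟨lift S x (xor b q.side), hmm, ?_⟩
    dsimp only
    rw [lift_pt, hxy]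
    by_cases hxS : x ∈ S
    · rw [lift_pt_side hxS]
      · rw [← Bool.xor_assoc, Bool.xor_self, Bool.false_xor, lift_side]
      · intro hx0
        have : x = c := le_antisymm (hx0 ▸ h0 _) hx.1
        have := hne.2
        grind
      · intro hx1
        have : x = d := le_antisymm hx.2 (hx1 ▸ h1 _)
        have := hne.1
        grind
    · have hqS : q.pt ∉ S := by rw [← hxy, hS x hx]; exact hxS
      conv_rhs => rw [← lift_side q]
      unfold lift
      simp [hqS]

end Branch

end Disconnection

/-- `τ : [0,1] → [0,1]` is piecewise monotonic with associated partition
`0 = a 0 < a 1 < ⋯ < a n = 1`, having the `n` intervals of monotonicity `(a (i-1), a i)`. The partition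
need not be the maximal one, and the values of `τ` at the points of the partition are arbitrary. -/
structure IsPiecewiseMonotonic {n : ℕ} (τ : unitInterval → unitInterval)
    (a : Fin (n + 1) → unitInterval) : Prop where
  strictMono : StrictMono a
  first : a 0 = 0
  last : a (Fin.last n) = 1
  continuousOn : ∀ i : Fin n, ContinuousOn τ (Ioo (a i.castSucc) (a i.succ))
  monotonic : ∀ i : Fin n, StrictMonoOn τ (Ioo (a i.castSucc) (a i.succ)) ∨
    StrictAntiOn τ (Ioo (a i.castSucc) (a i.succ))

/-- The multivalued map `τ̂`: the set of the left and right limits of `τ` at `x` (only the right limit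
at `0`, only the left limit at `1`). -/
def oneSidedLimits (τ : unitInterval → unitInterval) (x : unitInterval) : Set unitInterval :=
  {y | (x ≠ 0 ∧ Tendsto τ (𝓝[<] x) (𝓝 y)) ∨ (x ≠ 1 ∧ Tendsto τ (𝓝[>] x) (𝓝 y))}

/-- `τ̂(A)`. -/
def hatImage (τ : unitInterval → unitInterval) (A : Set unitInterval) : Set unitInterval :=
  ⋃ x ∈ A, oneSidedLimits τ x

/-- `τ̂⁻¹(A) = {x | τ̂(x) ∩ A ≠ ∅}`. -/
def hatPreimage (τ : unitInterval → unitInterval) (A : Set unitInterval) : Set unitInterval :=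
  {x | (oneSidedLimits τ x ∩ A).Nonempty}

/-- The forward orbit of `A` under `τ̂`: the union of `τ̂ᵏ(A)` over `k ≥ 0`. -/
def hatOrbit (τ : unitInterval → unitInterval) (A : Set unitInterval) : Set unitInterval :=
  ⋃ k : ℕ, (hatImage τ)^[k] A

/-- The smallest set which contains `C` and is closed under `τ̂` and `τ̂⁻¹`. -/
def generalizedOrbit (τ : unitInterval → unitInterval) (C : Set unitInterval) :
    Set unitInterval :=
  ⋂₀ {S | C ⊆ S ∧ hatImage τ S ⊆ S ∧ hatPreimage τ S ⊆ S}

/-- The continuous extension `τᵢ` of the restriction of `τ` to the `i`-th open interval of the partition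
to the closed interval. -/
noncomputable def branch {n : ℕ} (τ : unitInterval → unitInterval) (a : Fin (n + 1) → unitInterval)
    (i : Fin n) : unitInterval → unitInterval :=
  extendFrom (Ioo (a i.castSucc) (a i.succ)) τ

lemma subset_generalizedOrbit (τ : unitInterval → unitInterval) (C : Set unitInterval) :
    C ⊆ generalizedOrbit τ C := fun _ hx _ hS => hS.1 hx

lemma mem_generalizedOrbit_iff {τ : unitInterval → unitInterval} {C : Set unitInterval}
    {x y : unitInterval} (h : y ∈ oneSidedLimits τ x) :
    y ∈ generalizedOrbit τ C ↔ x ∈ generalizedOrbit τ C :=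
  ⟨fun hy S hS => hS.2.2 ⟨y, h, hy S hS⟩,
    fun hx S hS => hS.2.1 (mem_iUnion₂.2 ⟨x, hx S hS, h⟩)⟩

namespace IsPiecewiseMonotonic

variable {n : ℕ} {τ : unitInterval → unitInterval} {a : Fin (n + 1) → unitInterval}

lemma lt (h : IsPiecewiseMonotonic τ a) (i : Fin n) : a i.castSucc < a i.succ :=
  h.strictMono i.castSucc_lt_succ

lemma tendsto_left (h : IsPiecewiseMonotonic τ a) (i : Fin n) :
    ∃ l, Tendsto τ (𝓝[>] (a i.castSucc)) (𝓝 l) := by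
  rcases h.monotonic i with hm | hm
  · exact ⟨_, hm.monotoneOn.tendsto_nhdsWithin_Ioo_right (nonempty_Ioo.2 (h.lt i))
      (OrderBot.bddBelow _)⟩
  · exact ⟨_, hm.antitoneOn.tendsto_nhdsWithin_Ioo_right (nonempty_Ioo.2 (h.lt i))
      (OrderTop.bddAbove _)⟩

lemma tendsto_right (h : IsPiecewiseMonotonic τ a) (i : Fin n) :
    ∃ l, Tendsto τ (𝓝[<] (a i.succ)) (𝓝 l) := by
  rcases h.monotonic i with hm | hm
  · exact ⟨_, hm.monotoneOn.tendsto_nhdsWithin_Ioo_left (nonempty_Ioo.2 (h.lt i))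
      (OrderTop.bddAbove _)⟩
  · exact ⟨_, hm.antitoneOn.tendsto_nhdsWithin_Ioo_left (nonempty_Ioo.2 (h.lt i))
      (OrderBot.bddBelow _)⟩

lemma continuousOn_branch (h : IsPiecewiseMonotonic τ a) (i : Fin n) :
    ContinuousOn (branch τ a i) (Icc (a i.castSucc) (a i.succ)) := by
  obtain ⟨l, hl⟩ := h.tendsto_left i
  obtain ⟨r, hr⟩ := h.tendsto_right i
  exact continuousOn_Icc_extendFrom_Ioo (h.continuousOn i) hl hr

lemma branch_eq (h : IsPiecewiseMonotonic τ a) (i : Fin n) {x : unitInterval}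
    (hx : x ∈ Ioo (a i.castSucc) (a i.succ)) : branch τ a i x = τ x :=
  extendFrom_eq (subset_closure hx) (h.continuousOn i x hx)

lemma tendsto_nhdsGT (h : IsPiecewiseMonotonic τ a) (i : Fin n) {x : unitInterval}
    (hx : x ∈ Ico (a i.castSucc) (a i.succ)) : Tendsto τ (𝓝[>] x) (𝓝 (branch τ a i x)) := by
  have := (h.continuousOn_branch i x (Ico_subset_Icc_self hx)).mono_left
    (nhdsWithin_mono x (Ioo_subset_Icc_self.trans (Icc_subset_Icc_left hx.1)))
  rw [nhdsWithin_Ioo_eq_nhdsGT hx.2] at this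
  refine this.congr' ?_
  filter_upwards [Ioo_mem_nhdsGT hx.2] with y hy
  exact h.branch_eq i ⟨hx.1.trans_lt hy.1, hy.2⟩

lemma tendsto_nhdsLT (h : IsPiecewiseMonotonic τ a) (i : Fin n) {x : unitInterval}
    (hx : x ∈ Ioc (a i.castSucc) (a i.succ)) : Tendsto τ (𝓝[<] x) (𝓝 (branch τ a i x)) := by
  have := (h.continuousOn_branch i x (Ioc_subset_Icc_self hx)).mono_left
    (nhdsWithin_mono x (Ioo_subset_Icc_self.trans (Icc_subset_Icc_right hx.2)))
  rw [nhdsWithin_Ioo_eq_nhdsLT hx.1] at this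
  refine this.congr' ?_
  filter_upwards [Ioo_mem_nhdsLT hx.1] with y hy
  exact h.branch_eq i ⟨hy.1, hy.2.trans_le hx.2⟩

lemma branch_mem (h : IsPiecewiseMonotonic τ a) (i : Fin n) {x : unitInterval}
    (hx : x ∈ Icc (a i.castSucc) (a i.succ)) : branch τ a i x ∈ oneSidedLimits τ x := by
  rcases eq_or_lt_of_le hx.1 with rfl | h1
  · exact Or.inr ⟨fun e => absurd (h.lt i) (not_lt.2 (e ▸ unitInterval.le_one')),
      h.tendsto_nhdsGT i ⟨le_rfl, h.lt i⟩⟩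
  · exact Or.inl ⟨fun e => absurd h1 (not_lt.2 (e ▸ unitInterval.nonneg')),
      h.tendsto_nhdsLT i ⟨h1, hx.2⟩⟩

lemma exists_mem_Ioc (h : IsPiecewiseMonotonic τ a) {x : unitInterval} (hx : x ≠ 0) :
    ∃ i : Fin n, x ∈ Ioc (a i.castSucc) (a i.succ) := by
  by_contra! hcon
  have : ∀ i : Fin (n + 1), a i < x := by
    intro i
    induction i using Fin.induction with
    | zero => rw [h.first]; exact lt_of_le_of_ne unitInterval.nonneg' hx.symm
    | succ i ih => exact not_le.1 fun hle => hcon i ⟨ih, hle⟩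
  exact absurd (this (Fin.last n)) (not_lt.2 (h.last ▸ unitInterval.le_one'))

lemma exists_mem_Ico (h : IsPiecewiseMonotonic τ a) {x : unitInterval} (hx : x ≠ 1) :
    ∃ i : Fin n, x ∈ Ico (a i.castSucc) (a i.succ) := by
  by_contra! hcon
  have : ∀ i : Fin (n + 1), a i ≤ x := by
    intro i
    induction i using Fin.induction with
    | zero => rw [h.first]; exact unitInterval.nonneg'
    | succ i ih => exact not_lt.1 fun hle => hcon i ⟨ih, hle⟩
  exact hx (le_antisymm unitInterval.le_one' (h.last ▸ this (Fin.last n)))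

lemma exists_branch_eq (h : IsPiecewiseMonotonic τ a) {x y : unitInterval}
    (hy : y ∈ oneSidedLimits τ x) :
    ∃ i : Fin n, x ∈ Icc (a i.castSucc) (a i.succ) ∧ branch τ a i x = y := by
  rcases hy with ⟨hx, hy⟩ | ⟨hx, hy⟩
  · obtain ⟨i, hi⟩ := h.exists_mem_Ioc hx
    have : (𝓝[<] x).NeBot := nhdsLT_neBot_of_exists_lt ⟨_, hi.1⟩
    exact ⟨i, Ioc_subset_Icc_self hi, tendsto_nhds_unique (h.tendsto_nhdsLT i hi) hy⟩
  · obtain ⟨i, hi⟩ := h.exists_mem_Ico hx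
    have : (𝓝[>] x).NeBot := nhdsGT_neBot_of_exists_gt ⟨_, hi.2⟩
    exact ⟨i, Ico_subset_Icc_self hi, tendsto_nhds_unique (h.tendsto_nhdsGT i hi) hy⟩

lemma strictMonoOn_of_Ioo {f : unitInterval → unitInterval} {c d : unitInterval}
    (hf : StrictMonoOn f (Ioo c d)) (hc : ContinuousOn f (Icc c d)) :
    StrictMonoOn f (Icc c d) := by
  intro x hx y hy hxy
  obtain ⟨u, hxu, huy⟩ := exists_between hxy
  obtain ⟨v, huv, hvy⟩ := exists_between huy
  have hu : u ∈ Ioo c d := ⟨hx.1.trans_lt hxu, huy.trans_le hy.2⟩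
  have hv : v ∈ Ioo c d := ⟨hu.1.trans huv, hvy.trans_le hy.2⟩
  have h1 : f x ≤ f u := by
    have t := (hc x hx).mono_left
      (nhdsWithin_mono x (Ioo_subset_Icc_self.trans (Icc_subset_Icc hx.1 hu.2.le)))
    rw [nhdsWithin_Ioo_eq_nhdsGT hxu] at t
    have : (𝓝[>] x).NeBot := nhdsGT_neBot_of_exists_gt ⟨_, hxu⟩
    refine le_of_tendsto t ?_
    filter_upwards [Ioo_mem_nhdsGT hxu] with z hz
    exact (hf ⟨hx.1.trans_lt hz.1, hz.2.trans hu.2⟩ hu hz.2).le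
  have h2 : f v ≤ f y := by
    have t := (hc y hy).mono_left
      (nhdsWithin_mono y (Ioo_subset_Icc_self.trans (Icc_subset_Icc hv.1.le hy.2)))
    rw [nhdsWithin_Ioo_eq_nhdsLT hvy] at t
    have : (𝓝[<] y).NeBot := nhdsLT_neBot_of_exists_lt ⟨_, hvy⟩
    refine ge_of_tendsto t ?_
    filter_upwards [Ioo_mem_nhdsLT hvy] with z hz
    exact (hf hv ⟨hv.1.trans hz.1, hz.2.trans_le hy.2⟩ hz.1).le
  exact h1.trans_lt ((hf hu hv huv).trans_le h2)

lemma strictAntiOn_of_Ioo {f : unitInterval → unitInterval} {c d : unitInterval}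
    (hf : StrictAntiOn f (Ioo c d)) (hc : ContinuousOn f (Icc c d)) :
    StrictAntiOn f (Icc c d) := by
  have := strictMonoOn_of_Ioo (f := fun x => unitInterval.symm (f x))
    (fun x hx y hy hxy => unitInterval.strictAnti_symm (hf hx hy hxy))
    (unitInterval.continuous_symm.comp_continuousOn hc)
  exact fun x hx y hy hxy => unitInterval.strictAnti_symm.lt_iff_gt.1 (this hx hy hxy)

lemma branch_strictMonoOn (h : IsPiecewiseMonotonic τ a) (i : Fin n)
    (hm : StrictMonoOn τ (Ioo (a i.castSucc) (a i.succ))) :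
    StrictMonoOn (branch τ a i) (Icc (a i.castSucc) (a i.succ)) :=
  strictMonoOn_of_Ioo (hm.congr fun _ hx => (h.branch_eq i hx).symm) (h.continuousOn_branch i)

lemma branch_strictAntiOn (h : IsPiecewiseMonotonic τ a) (i : Fin n)
    (hm : StrictAntiOn τ (Ioo (a i.castSucc) (a i.succ))) :
    StrictAntiOn (branch τ a i) (Icc (a i.castSucc) (a i.succ)) :=
  strictAntiOn_of_Ioo (hm.congr fun _ hx => (h.branch_eq i hx).symm) (h.continuousOn_branch i)

/-- The points at which the interval is cut open. -/
abbrev cuts {n : ℕ} (τ : unitInterval → unitInterval) (a : Fin (n + 1) → unitInterval) :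
    Set unitInterval :=
  generalizedOrbit τ (range a)

/-- The clopen order interval `[a(i-1)⁺, a(i)⁻]` of the disconnection. -/
abbrev piece {n : ℕ} (τ : unitInterval → unitInterval) (a : Fin (n + 1) → unitInterval)
    (i : Fin n) : Set (Disconnection (cuts τ a)) :=
  Icc (Disconnection.lift _ (a i.castSucc) true) (Disconnection.lift _ (a i.succ) false)

lemma mem_cuts (i : Fin (n + 1)) : a i ∈ cuts τ a := subset_generalizedOrbit _ _ ⟨i, rfl⟩

lemma mem_piece (h : IsPiecewiseMonotonic τ a) (i : Fin n) (p : Disconnection (cuts τ a)) :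
    p ∈ piece τ a i ↔ (p.side = true ∧ p.pt ∈ Ico (a i.castSucc) (a i.succ)) ∨
      (p.side = false ∧ p.pt ∈ Ioc (a i.castSucc) (a i.succ)) :=
  Disconnection.mem_Icc_lift (mem_cuts _) (mem_cuts _) (h.lt i) p

lemma exists_mem_piece (h : IsPiecewiseMonotonic τ a) (p : Disconnection (cuts τ a)) :
    ∃ i, p ∈ piece τ a i := by
  cases hs : p.side
  · obtain ⟨i, hi⟩ := h.exists_mem_Ioc (x := p.pt) fun e => by
      simp [Disconnection.side_zero p e] at hs
    exact ⟨i, (h.mem_piece i p).2 (Or.inr ⟨hs, hi⟩)⟩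
  · obtain ⟨i, hi⟩ := h.exists_mem_Ico (x := p.pt) fun e => by
      simp [Disconnection.side_one p e] at hs
    exact ⟨i, (h.mem_piece i p).2 (Or.inl ⟨hs, hi⟩)⟩

lemma piece_unique (h : IsPiecewiseMonotonic τ a) {i j : Fin n} {p : Disconnection (cuts τ a)}
    (hi : p ∈ piece τ a i) (hj : p ∈ piece τ a j) : i = j := by
  rw [h.mem_piece] at hi hj
  by_contra hne
  wlog hij : i < j generalizing i j
  · exact this hj hi (Ne.symm hne) (lt_of_le_of_ne (not_lt.1 hij) (Ne.symm hne))
  have : a i.succ ≤ a j.castSucc := h.strictMono.monotone (by simpa [Fin.le_def] using hij)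
  grind

/-- The index of the piece which contains `p`; the pieces partition the disconnection. -/
noncomputable def index (h : IsPiecewiseMonotonic τ a) (p : Disconnection (cuts τ a)) : Fin n :=
  (h.exists_mem_piece p).choose

lemma index_eq (h : IsPiecewiseMonotonic τ a) {i : Fin n} {p : Disconnection (cuts τ a)}
    (hp : p ∈ piece τ a i) : h.index p = i :=
  h.piece_unique (h.exists_mem_piece p).choose_spec hp

open Classical in
/-- The local homeomorphism `σ` associated with `τ`: on the `i`-th piece it is `x^± ↦ τᵢ(x)^±` if `τᵢ` is
increasing, and `x^± ↦ τᵢ(x)^∓` if `τᵢ` is decreasing. It is the unique continuous map for which the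
collapse map intertwines `σ` and `τ` above the points at which the interval is not cut. -/
noncomputable def localHomeo (h : IsPiecewiseMonotonic τ a) (p : Disconnection (cuts τ a)) :
    Disconnection (cuts τ a) :=
  Disconnection.lift _ (branch τ a (h.index p) p.pt)
    (if StrictMonoOn τ (Ioo (a (h.index p).castSucc) (a (h.index p).succ)) then p.side
      else !p.side)

open Classical in
/-- `true` if `τ` is decreasing on the `i`-th interval. -/
noncomputable def flip (τ : unitInterval → unitInterval) (a : Fin (n + 1) → unitInterval)
    (i : Fin n) : Bool := !decide (StrictMonoOn τ (Ioo (a i.castSucc) (a i.succ)))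

lemma localHomeo_eq (h : IsPiecewiseMonotonic τ a) {i : Fin n} {p : Disconnection (cuts τ a)}
    (hp : p ∈ piece τ a i) : h.localHomeo p =
      Disconnection.lift _ (branch τ a i p.pt) (xor (flip τ a i) p.side) := by
  unfold localHomeo flip
  rw [h.index_eq hp]
  split_ifs with hm <;> simp [hm]

lemma branch_monotonic (h : IsPiecewiseMonotonic τ a) (i : Fin n) :
    if flip τ a i then StrictAntiOn (branch τ a i) (Icc (a i.castSucc) (a i.succ))
      else StrictMonoOn (branch τ a i) (Icc (a i.castSucc) (a i.succ)) := by
  unfold flip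
  by_cases hm : StrictMonoOn τ (Ioo (a i.castSucc) (a i.succ))
  · simpa [hm] using h.branch_strictMonoOn i hm
  · simpa [hm] using h.branch_strictAntiOn i ((h.monotonic i).resolve_left hm)

lemma branch_mem_cuts (h : IsPiecewiseMonotonic τ a) (i : Fin n) :
    ∀ x ∈ Icc (a i.castSucc) (a i.succ), branch τ a i x ∈ cuts τ a ↔ x ∈ cuts τ a :=
  fun _ hx => mem_generalizedOrbit_iff (h.branch_mem i hx)

lemma image_piece (h : IsPiecewiseMonotonic τ a) (i : Fin n) :
    h.localHomeo '' piece τ a i =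
      Icc (Disconnection.lift _ (if flip τ a i then branch τ a i (a i.succ)
          else branch τ a i (a i.castSucc)) true)
        (Disconnection.lift _ (if flip τ a i then branch τ a i (a i.castSucc)
          else branch τ a i (a i.succ)) false) := by
  rw [← Disconnection.image_lift (flip τ a i) (mem_cuts _) (mem_cuts _) (h.lt i)
    (h.branch_monotonic i) (h.continuousOn_branch i) (h.branch_mem_cuts i)]
  exact image_congr fun p hp => h.localHomeo_eq hp

lemma endpoints_lt (h : IsPiecewiseMonotonic τ a) (i : Fin n) :
    (if flip τ a i then branch τ a i (a i.succ) else branch τ a i (a i.castSucc)) <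
      (if flip τ a i then branch τ a i (a i.castSucc) else branch τ a i (a i.succ)) := by
  have := h.branch_monotonic i
  have h1 : a i.castSucc ∈ Icc (a i.castSucc) (a i.succ) := ⟨le_rfl, (h.lt i).le⟩
  have h2 : a i.succ ∈ Icc (a i.castSucc) (a i.succ) := ⟨(h.lt i).le, le_rfl⟩
  split_ifs at * with hf <;> exact this h1 h2 (h.lt i)

lemma endpoints_mem (h : IsPiecewiseMonotonic τ a) (i : Fin n) :
    (if flip τ a i then branch τ a i (a i.succ) else branch τ a i (a i.castSucc)) ∈ cuts τ a ∧
      (if flip τ a i then branch τ a i (a i.castSucc) else branch τ a i (a i.succ)) ∈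
        cuts τ a := by
  have h1 := (h.branch_mem_cuts i _ ⟨le_rfl, (h.lt i).le⟩).2 (mem_cuts _)
  have h2 := (h.branch_mem_cuts i _ ⟨(h.lt i).le, le_rfl⟩).2 (mem_cuts _)
  split_ifs <;> exact ⟨by assumption, by assumption⟩

lemma isClopen_piece (h : IsPiecewiseMonotonic τ a) (i : Fin n) : IsClopen (piece τ a i) :=
  Disconnection.isClopen_Icc (mem_cuts _) (mem_cuts _) (h.lt i)

lemma isClopen_image_piece (h : IsPiecewiseMonotonic τ a) (i : Fin n) :
    IsClopen (h.localHomeo '' piece τ a i) := by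
  rw [h.image_piece]
  exact Disconnection.isClopen_Icc (h.endpoints_mem i).1 (h.endpoints_mem i).2 (h.endpoints_lt i)

lemma localHomeo_monotonic (h : IsPiecewiseMonotonic τ a) (i : Fin n) :
    StrictMonoOn h.localHomeo (piece τ a i) ∨ StrictAntiOn h.localHomeo (piece τ a i) := by
  have hb := h.branch_monotonic i
  have e : EqOn h.localHomeo _ (piece τ a i) := fun p hp => h.localHomeo_eq hp
  cases hf : flip τ a i
  · rw [hf] at hb
    refine Or.inl (StrictMonoOn.congr (Disconnection.strictMonoOn_lift (mem_cuts _) (mem_cuts _)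
      (h.lt i) hb (h.branch_mem_cuts i)) fun p hp => ?_)
    rw [e hp]; simp [hf]
  · rw [hf] at hb
    refine Or.inr (StrictAntiOn.congr (Disconnection.strictAntiOn_lift (mem_cuts _) (mem_cuts _)
      (h.lt i) hb (h.branch_mem_cuts i)) fun p hp => ?_)
    rw [e hp]; simp [hf]

/-- A strictly monotone map of a clopen order interval onto a clopen order interval is
continuous and open there. -/
lemma homeo_of_strictMonoOn {X Y : Type*} [LinearOrder X] [TopologicalSpace X] [OrderTopology X]
    [LinearOrder Y] [TopologicalSpace Y] [OrderTopology Y] {f : X → Y} {s : Set X}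
    (hs : s.OrdConnected) (ht : (f '' s).OrdConnected) (hto : IsOpen (f '' s))
    (hf : StrictMonoOn f s) :
    ContinuousOn f s ∧ ∀ U, IsOpen U → IsOpen (f '' (U ∩ s)) := by
  let e : s ≃ₜ (f '' s) := (hf.orderIso f s).toHomeomorph
  have he : ∀ x : s, (e x : Y) = f x := fun _ => rfl
  constructor
  · rw [continuousOn_iff_continuous_domRestrict]
    exact continuous_subtype_val.comp e.continuous
  · intro U hU
    have : f '' (U ∩ s) = Subtype.val '' (e '' (Subtype.val ⁻¹' U)) := by
      ext y
      constructor
      · rintro ⟨x, ⟨hxU, hxs⟩, rfl⟩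
        exact ⟨e ⟨x, hxs⟩, ⟨⟨x, hxs⟩, hxU, rfl⟩, he _⟩
      · rintro ⟨_, ⟨x, hx, rfl⟩, rfl⟩
        exact ⟨x, ⟨hx, x.2⟩, (he x).symm⟩
    rw [this]
    exact hto.isOpenMap_subtype_val _ (e.isOpenMap _ (hU.preimage continuous_subtype_val))

lemma localHomeo_homeo (h : IsPiecewiseMonotonic τ a) (i : Fin n) :
    ContinuousOn h.localHomeo (piece τ a i) ∧
      ∀ U, IsOpen U → IsOpen (h.localHomeo '' (U ∩ piece τ a i)) := by
  have hO := (h.isClopen_image_piece i).isOpen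
  have hC : (h.localHomeo '' piece τ a i).OrdConnected := by
    rw [h.image_piece]; exact ordConnected_Icc
  rcases h.localHomeo_monotonic i with hm | hm
  · exact homeo_of_strictMonoOn ordConnected_Icc hC hO hm
  · exact homeo_of_strictMonoOn (Y := (Disconnection (cuts τ a))ᵒᵈ)
      (f := fun p => OrderDual.toDual (h.localHomeo p)) ordConnected_Icc hC.dual hO hm.dual_right

theorem isPiecewiseHomeo (h : IsPiecewiseMonotonic τ a) : IsPiecewiseHomeo h.localHomeo where
  continuous := by
    rw [continuous_iff_continuousAt]
    intro p
    obtain ⟨i, hi⟩ := h.exists_mem_piece p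
    exact (h.localHomeo_homeo i).1.continuousAt ((h.isClopen_piece i).isOpen.mem_nhds hi)
  isOpenMap U hU := by
    have : h.localHomeo '' U = ⋃ i, h.localHomeo '' (U ∩ piece τ a i) := by
      rw [← image_iUnion, ← inter_iUnion,
        iUnion_eq_univ_iff.2 fun p => h.exists_mem_piece p, inter_univ]
    rw [this]
    exact isOpen_iUnion fun i => (h.localHomeo_homeo i).2 U hU
  exists_partition := by
    refine ⟨n, piece τ a, h.isClopen_piece, fun i j hij => disjoint_left.2 fun p hi hj =>
      hij (h.piece_unique hi hj), iUnion_eq_univ_iff.2 h.exists_mem_piece, fun i =>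
      ⟨?_, h.isClopen_image_piece i⟩⟩
    rcases h.localHomeo_monotonic i with hm | hm
    · exact hm.injOn
    · exact hm.injOn

theorem localHomeo_surjective (h : IsPiecewiseMonotonic τ a) (hs : hatImage τ univ = univ) :
    Function.Surjective h.localHomeo := by
  have hcov : ∀ y, ∃ i : Fin n,
      y ∈ Icc (if flip τ a i then branch τ a i (a i.succ) else branch τ a i (a i.castSucc))
        (if flip τ a i then branch τ a i (a i.castSucc) else branch τ a i (a i.succ)) := by
    intro y
    obtain ⟨x, -, hx⟩ := mem_iUnion₂.1 (hs.symm ▸ mem_univ y : y ∈ hatImage τ univ)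
    obtain ⟨i, hi, rfl⟩ := h.exists_branch_eq hx
    refine ⟨i, ?_⟩
    have := h.branch_monotonic i
    have h1 : a i.castSucc ∈ Icc (a i.castSucc) (a i.succ) := ⟨le_rfl, (h.lt i).le⟩
    have h2 : a i.succ ∈ Icc (a i.castSucc) (a i.succ) := ⟨(h.lt i).le, le_rfl⟩
    split_ifs at * with hf
    · exact ⟨this.antitoneOn hi h2 hi.2, this.antitoneOn h1 hi hi.1⟩
    · exact ⟨this.monotoneOn h1 hi hi.1, this.monotoneOn hi h2 hi.2⟩
  obtain ⟨lo, hi, hcov, hpc⟩ : ∃ lo hi : Fin n → unitInterval, (∀ y, ∃ i, y ∈ Icc (lo i) (hi i)) ∧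
      ∀ i q, q ∈ h.localHomeo '' piece τ a i ↔ (q.side = true ∧ q.pt ∈ Ico (lo i) (hi i)) ∨
        (q.side = false ∧ q.pt ∈ Ioc (lo i) (hi i)) :=
    ⟨_, _, hcov, fun i q => by
      rw [h.image_piece]
      exact Disconnection.mem_Icc_lift (h.endpoints_mem i).1 (h.endpoints_mem i).2
        (h.endpoints_lt i) q⟩
  intro q
  suffices ∃ i, q ∈ h.localHomeo '' piece τ a i by
    obtain ⟨i, p, -, rfl⟩ := this
    exact ⟨p, rfl⟩
  simp only [hpc]
  by_contra! hcon
  cases hs : q.side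
  · have h0 : 0 < q.pt := lt_of_le_of_ne unitInterval.nonneg' fun e => by
      simp [Disconnection.side_zero q e.symm] at hs
    have : (𝓝[<] q.pt).NeBot := nhdsLT_neBot_of_exists_lt ⟨_, h0⟩
    have hev : ∀ᶠ z in 𝓝[<] q.pt, ∀ i, z ∉ Icc (lo i) (hi i) := by
      rw [eventually_all]
      intro i
      have hi' := (hcon i).2 hs
      by_cases hlo : lo i < q.pt
      · have : hi i < q.pt := not_le.1 fun hle => hi' ⟨hlo, hle⟩
        filter_upwards [Ioo_mem_nhdsLT this] with z hz hz'
        exact absurd hz.1 (not_lt.2 hz'.2)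
      · filter_upwards [self_mem_nhdsWithin] with z hz hz'
        exact hlo (hz'.1.trans_lt hz)
    obtain ⟨z, hz⟩ := hev.exists
    obtain ⟨i, hi⟩ := hcov z
    exact hz i hi
  · have h1 : q.pt < 1 := lt_of_le_of_ne unitInterval.le_one' fun e => by
      simp [Disconnection.side_one q e] at hs
    have : (𝓝[>] q.pt).NeBot := nhdsGT_neBot_of_exists_gt ⟨_, h1⟩
    have hev : ∀ᶠ z in 𝓝[>] q.pt, ∀ i, z ∉ Icc (lo i) (hi i) := by
      rw [eventually_all]
      intro i
      have hi' := (hcon i).1 hs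
      by_cases hlo : q.pt < hi i
      · have : q.pt < lo i := not_le.1 fun hle => hi' ⟨hle, hlo⟩
        filter_upwards [Ioo_mem_nhdsGT this] with z hz hz'
        exact absurd hz.2 (not_lt.2 hz'.1)
      · filter_upwards [self_mem_nhdsWithin] with z hz hz'
        exact hlo (lt_of_lt_of_le hz hz'.2)
    obtain ⟨z, hz⟩ := hev.exists
    obtain ⟨i, hi⟩ := hcov z
    exact hz i hi

lemma pt_localHomeo (h : IsPiecewiseMonotonic τ a) (p : Disconnection (cuts τ a))
    (hp : p.pt ∉ cuts τ a) : (h.localHomeo p).pt = τ p.pt := by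
  obtain ⟨i, hi⟩ := h.exists_mem_piece p
  rw [h.localHomeo_eq hi, Disconnection.lift_pt]
  have h1 : p.pt ≠ a i.castSucc := fun e => hp (e ▸ mem_cuts _)
  have h2 : p.pt ≠ a i.succ := fun e => hp (e ▸ mem_cuts _)
  rw [h.mem_piece] at hi
  exact h.branch_eq i (by grind)

end IsPiecewiseMonotonic

/-- The abelian group `DG(τ)`, for the given partition: the group of classes of functions in `C(X, ℤ)`,
where `X` is the disconnection of `[0,1]` at the generalized orbit of the partition, and `f ∼ g` iff
`Lᵏ f = Lᵏ g` for some `k ≥ 0`, `L` being the transfer map of the associated local homeomorphism. -/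
abbrev DG {n : ℕ} {τ : unitInterval → unitInterval} {a : Fin (n + 1) → unitInterval}
    (h : IsPiecewiseMonotonic τ a) : Type :=
  DimensionGroup (transfer h.isPiecewiseHomeo)

/-- The class `[f]` in `DG(τ)` of `f ∈ C(X, ℤ)`. -/
noncomputable def DG.mk {n : ℕ} {τ : unitInterval → unitInterval} {a : Fin (n + 1) → unitInterval}
    (h : IsPiecewiseMonotonic τ a) :
    C(Disconnection (generalizedOrbit τ (range a)), ℤ) →+ DG h :=
  QuotientAddGroup.mk' (eventualKernel (transfer h.isPiecewiseHomeo))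

/-- An automorphism `e` of an abelian group `M` makes `M` a `ℤ[t,t⁻¹]`-module, in which `∑ zᵢ tⁱ` acts as
`∑ zᵢ eⁱ`. -/
noncomputable abbrev laurentModule {M : Type*} [AddCommGroup M] (e : M ≃+ M) :
    Module ℤ[T;T⁻¹] M :=
  Module.compHom M (AddMonoidAlgebra.lift ℤ (Module.End ℤ M) ℤ
    ((Units.coeHom (Module.End ℤ M)).comp (zpowersHom (Module.End ℤ M)ˣ
      ((LinearMap.GeneralLinearGroup.generalLinearEquiv ℤ M).symm e.toIntLinearEquiv)))).toRingHom

/-- `τ` is surjective in the sense that `τ̂([0,1]) = [0,1]`. For continuous `τ` this is surjectivity. -/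
def IsHatSurjective (τ : unitInterval → unitInterval) : Prop :=
  hatImage τ univ = univ

/-- `L_*` as an automorphism of `DG(τ)`, for surjective `τ`. -/
noncomputable def DG.automorphism {n : ℕ} {τ : unitInterval → unitInterval}
    {a : Fin (n + 1) → unitInterval} (h : IsPiecewiseMonotonic τ a) (hs : IsHatSurjective τ) :
    DG h ≃+ DG h :=
  AddEquiv.ofBijective (inducedMap (transfer h.isPiecewiseHomeo))
    (inducedMap_bijective _ (transfer_surjective _ (h.localHomeo_surjective hs)))

/-- The dimension module of a surjective `τ`: the group `DG(τ)`, on which `t` acts as `L_*`. -/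
def DimensionModule {n : ℕ} {τ : unitInterval → unitInterval} {a : Fin (n + 1) → unitInterval}
    (h : IsPiecewiseMonotonic τ a) (_hs : IsHatSurjective τ) : Type :=
  DG h

noncomputable instance {n : ℕ} {τ : unitInterval → unitInterval} {a : Fin (n + 1) → unitInterval}
    (h : IsPiecewiseMonotonic τ a) (hs : IsHatSurjective τ) :
    AddCommGroup (DimensionModule h hs) :=
  inferInstanceAs (AddCommGroup (DG h))

noncomputable instance {n : ℕ} {τ : unitInterval → unitInterval} {a : Fin (n + 1) → unitInterval}
    (h : IsPiecewiseMonotonic τ a) (hs : IsHatSurjective τ) :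
    Module ℤ[T;T⁻¹] (DimensionModule h hs) :=
  laurentModule (M := DG h) (DG.automorphism h hs)

/-- The group `ℤ`, as a `ℤ[t,t⁻¹]`-module on which `t` acts trivially. -/
def TrivialInt : Type := ℤ

instance : AddCommGroup TrivialInt := inferInstanceAs (AddCommGroup ℤ)

noncomputable instance : Module ℤ[T;T⁻¹] TrivialInt := laurentModule (AddEquiv.refl TrivialInt)

/-- There are no disjoint (nondegenerate) intervals `J`, `J'` with `τ(J) = τ(J')`. -/
def IsEssentiallyInjective (τ : unitInterval → unitInterval) : Prop :=
  ¬ ∃ J J' : Set unitInterval, J.OrdConnected ∧ J.Nontrivial ∧ J'.OrdConnected ∧ J'.Nontrivial ∧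
    Disjoint J J' ∧ τ '' J = τ '' J'

/-- Essential bijectivity: `τ` is surjective and essentially injective. -/
structure IsEssentiallyBijective (τ : unitInterval → unitInterval) : Prop where
  surjective : IsHatSurjective τ
  injective : IsEssentiallyInjective τ

/-- `τ` is a generalized interval exchange map of `[0,1)`, extended to `[0,1]` so as to be left
continuous at `1`; the partition is `a`. -/
structure IsGeneralizedIntervalExchange {n : ℕ} (τ : unitInterval → unitInterval)
    (a : Fin (n + 1) → unitInterval) : Prop extends IsPiecewiseMonotonic τ a where
  increasing : ∀ i : Fin n, StrictMonoOn τ (Ioo (a i.castSucc) (a i.succ))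
  bijOn : BijOn τ (Iio 1) (Iio 1)
  right_continuous : ∀ x ∈ Iio (1 : unitInterval), ContinuousWithinAt τ (Ici x) x
  left_continuous_one : ContinuousWithinAt τ (Iic 1) 1

/-- The points of `B` have infinite and disjoint orbits under `τ`. -/
def InfiniteDisjointOrbits (τ : unitInterval → unitInterval) (B : Set unitInterval) : Prop :=
  ∀ b₁ ∈ B, ∀ b₂ ∈ B, ∀ k l : ℕ, τ^[k] b₁ = τ^[l] b₂ → b₁ = b₂ ∧ k = l

/-! ### Modules over the Laurent polynomials and a criterion for a splitting into a free part and a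
copy of `ℤ`. -/

section LaurentModule
open LaurentPolynomial

/-! If `τ` is essentially bijective, the images of distinct intervals of the partition overlap at
most at endpoints, so `σ` is a bijection (`localHomeo_injective`, `localHomeo_surjective`). Then the
transfer map is composition with the inverse of `σ`, its inverse is `pullback`, and `DG(τ)` is `C(X,
ℤ)` itself (`bijective_mk`).

A function in `C(X, ℤ)` is determined up to a constant by its jumps `f(x⁺) - f(x⁻)`, of which only
finitely many are nonzero (`finite_jumps`, `eq_const_of_jump_eq_zero`). Off the partition, the jump
of `f ∘ σ` at `x` is, up to sign, the jump of `f` at `τ x` (`jump_pullback`). Hence negative powers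
of `t` move jumps backwards along orbits.

The orbit condition says that an interior partition point `c j` is not in the forward orbit of the
limits at the partition. It therefore has an infinite backward orbit `β j` that never returns to the
partition. Let `B` be the union of these orbits. Every cut lies in `B` or in the forward orbit of
the partition, so pulling back often enough pushes all jumps of a given function into `B`
(`exists_pullback_iterate`). On functions with jumps only in `B`, the jump at `β j k` can be read
off, up to sign, as the jump at `c j` of `tᵏ f`. The step functions at the `c j` thus behave like a
basis, and what they miss is the constants, on which `t` acts trivially.
`nonempty_linearEquiv_of_functionals` is the algebraic form of this argument.

For a generalized interval exchange, the limits at the partition are `0`, `1` or forward images of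
interior partition points (`hatImage_range_subset`). Infinite disjoint orbits then give the orbit
condition, which reduces the second statement to the first. -/

lemma laurentModule_T_one_smul {M : Type*} [AddCommGroup M] (e : M ≃+ M) (x : M) :
    (laurentModule e).toSMul.smul (T 1 : ℤ[T;T⁻¹]) x = e x := by
  change (AddMonoidAlgebra.lift ℤ (Module.End ℤ M) ℤ _ (AddMonoidAlgebra.single 1 1)) x = _
  rw [AddMonoidAlgebra.lift_single]
  simp only [MonoidHom.comp_apply, zpowersHom_apply, toAdd_ofAdd, zpow_one, one_smul]
  rfl

lemma T_neg_one_smul_T_one_smul {M : Type*} [AddCommGroup M] [Module ℤ[T;T⁻¹] M] (x : M) :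
    (T (-1) : ℤ[T;T⁻¹]) • (T 1 : ℤ[T;T⁻¹]) • x = x := by
  rw [smul_smul, ← T_add]; simp

lemma T_smul_of_T_one_smul {M : Type*} [AddCommGroup M] [Module ℤ[T;T⁻¹] M] {x : M}
    (hx : (T 1 : ℤ[T;T⁻¹]) • x = x) (k : ℤ) : (T k : ℤ[T;T⁻¹]) • x = x := by
  have hx' : (T (-1) : ℤ[T;T⁻¹]) • x = x := by
    conv_lhs => rw [← hx]
    exact T_neg_one_smul_T_one_smul x
  induction k with
  | zero => simp
  | succ k ih => rw [T_add, mul_smul, hx, ih]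
  | pred k ih => rw [sub_eq_add_neg, T_add, mul_smul, hx', ih]

lemma trivialInt_T_smul (k : ℤ) (x : TrivialInt) : (T k : ℤ[T;T⁻¹]) • x = x :=
  T_smul_of_T_one_smul (laurentModule_T_one_smul (AddEquiv.refl TrivialInt) x) k

lemma C_mul_T_smul {M : Type*} [AddCommGroup M] [Module ℤ[T;T⁻¹] M] (k c : ℤ) (x : M) :
    (C c * T k : ℤ[T;T⁻¹]) • x = c • (T k : ℤ[T;T⁻¹]) • x := by
  rw [mul_smul, ← Int.cast_smul_eq_zsmul ℤ[T;T⁻¹] c]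
  simp

/-- The module map `c ↦ c u` determined by a fixed point `u` of `t`. -/
noncomputable def TrivialInt.toModule {M : Type*} [AddCommGroup M] [Module ℤ[T;T⁻¹] M] (u : M)
    (hu : (T 1 : ℤ[T;T⁻¹]) • u = u) : TrivialInt →ₗ[ℤ[T;T⁻¹]] M where
  toFun := (zmultiplesHom M u : ℤ →+ M)
  map_add' := (zmultiplesHom M u).map_add
  map_smul' p x := by
    induction p using LaurentPolynomial.induction_on' with
    | add p q hp hq =>
      rw [add_smul, RingHom.id_apply, add_smul]
      exact ((zmultiplesHom M u).map_add _ _).trans (congrArg₂ _ hp hq)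
    | C_mul_T k c =>
      rw [RingHom.id_apply, C_mul_T_smul, C_mul_T_smul, trivialInt_T_smul]
      refine ((zmultiplesHom M u).map_zsmul _ _).trans (congrArg (c • ·) ?_)
      change (show ℤ from x) • u = (T k : ℤ[T;T⁻¹]) • (show ℤ from x) • u
      rw [smul_comm, T_smul_of_T_one_smul hu]

lemma laurent_smul_eq_sum {M : Type*} [AddCommGroup M] [Module ℤ[T;T⁻¹] M] (p : ℤ[T;T⁻¹]) (x : M) :
    p • x = p.coeff.sum fun k c => c • (T k : ℤ[T;T⁻¹]) • x := by
  induction p using LaurentPolynomial.induction_on' with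
  | add p q hp hq =>
    rw [add_smul, hp, hq, AddMonoidAlgebra.coeff_add]
    exact (Finsupp.sum_add_index' (fun k => zero_smul ℤ ((T k : ℤ[T;T⁻¹]) • x))
      fun k c d => add_smul c d ((T k : ℤ[T;T⁻¹]) • x)).symm
  | C_mul_T k c =>
    rw [C_mul_T_smul, ← single_eq_C_mul_T, AddMonoidAlgebra.coeff_single]
    exact (Finsupp.sum_single_index (h := fun k c => c • (T k : ℤ[T;T⁻¹]) • x)
      (zero_smul ℤ ((T k : ℤ[T;T⁻¹]) • x))).symm

section Functionals

variable {M : Type*} [AddCommGroup M] [Module ℤ[T;T⁻¹] M] {m : ℕ} {E : Fin m → M} {u : M}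
  {D : Fin m → M →+ ℤ}

/-- The functionals are controlled only on nonnegative powers of `t`. Shifting by a lower bound `d`
of the exponents makes all powers nonnegative and puts the coefficient at `d` in degree zero, the
only degree that `D j` sees. -/
lemma functional_T_smul_smul
    (hDE : ∀ j i (k : ℕ), D j ((T k : ℤ[T;T⁻¹]) • E i) = if j = i ∧ k = 0 then 1 else 0)
    {p : ℤ[T;T⁻¹]} {d : ℤ} (hd : ∀ k ∈ p.coeff.support, d ≤ k) (j i : Fin m) :
    D j ((T (-d) : ℤ[T;T⁻¹]) • p • E i) = if j = i then p.coeff d else 0 := by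
  have : ∀ k ∈ p.coeff.support,
      D j ((T (-d) : ℤ[T;T⁻¹]) • p.coeff k • (T k : ℤ[T;T⁻¹]) • E i) =
      if k = d then if j = i then p.coeff d else 0 else 0 := by
    intro k hk
    have hdk := hd k hk
    rw [smul_comm, smul_smul, ← T_add, map_zsmul,
      show -d + k = ((k - d).toNat : ℤ) by omega, hDE]
    have : (k - d).toNat = 0 ↔ k = d := by omega
    by_cases h1 : k = d
    · subst h1
      by_cases h2 : j = i <;> simp [h2]
    · rw [if_neg fun h => h1 (this.1 h.2), if_neg h1, smul_zero]
  rw [laurent_smul_eq_sum p, Finsupp.sum, Finset.smul_sum, map_sum, Finset.sum_congr rfl this,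
    Finset.sum_ite_eq']
  split_ifs with h1 h2 h2
  · rfl
  · rfl
  · exact (Finsupp.notMem_support_iff.1 h1).symm
  · rfl

/-- In a nontrivial relation, shift the lowest exponent that occurs to degree zero. A functional `D
j` then returns a nonzero lowest coefficient, while the multiple of `u` is fixed by the shift and
killed by `D j`. -/
lemma eq_zero_of_sum_smul_eq_zero (hu : (T 1 : ℤ[T;T⁻¹]) • u = u) (hDu : ∀ j, D j u = 0)
    (hDE : ∀ j i (k : ℕ), D j ((T k : ℤ[T;T⁻¹]) • E i) = if j = i ∧ k = 0 then 1 else 0)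
    (p : Fin m → ℤ[T;T⁻¹]) (c : ℤ) (h0 : ∑ i, p i • E i + c • u = 0) : p = 0 := by
  classical
  by_contra hp
  have hne : (Finset.univ.biUnion fun i => (p i).coeff.support).Nonempty := by
    obtain ⟨i, hi⟩ := Function.ne_iff.1 hp
    obtain ⟨k, hk⟩ := Finsupp.support_nonempty_iff.2 (AddMonoidAlgebra.coeff_eq_zero.not.2 hi)
    exact ⟨k, Finset.mem_biUnion.2 ⟨i, Finset.mem_univ _, hk⟩⟩
  -- The index `j` is one whose polynomial attains the minimum `d` of all exponents in all the `p
  -- i`.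
  obtain ⟨j, -, hj⟩ := Finset.mem_biUnion.1 (Finset.min'_mem _ hne)
  set d := Finset.min' _ hne
  have hd : ∀ i, ∀ k ∈ (p i).coeff.support, d ≤ k := fun i k hk =>
    Finset.min'_le _ _ (Finset.mem_biUnion.2 ⟨i, Finset.mem_univ _, hk⟩)
  refine Finsupp.mem_support_iff.1 hj ?_
  have := congrArg (fun x => D j ((T (-d) : ℤ[T;T⁻¹]) • x)) h0
  simp only [smul_add, Finset.smul_sum, map_add, map_sum,
    fun i => functional_T_smul_smul hDE (hd i) j i] at this
  rw [smul_comm, T_smul_of_T_one_smul hu, map_zsmul, hDu, smul_zero, smul_zero, map_zero,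
    add_zero, Finset.sum_ite_eq, if_pos (Finset.mem_univ _)] at this
  exact this

/-- Induction on the bound `K` beyond which the functionals vanish: a combination of the `t⁻ᴷ E i`
cancels the values at level `K` without disturbing higher levels. At `K = 0` all functionals vanish
and `hker` applies. Since `W` is stable under `t⁻¹`, the subtraction stays in `W`. -/
lemma mem_span_of_functionals
    (hDE : ∀ j i (k : ℕ), D j ((T k : ℤ[T;T⁻¹]) • E i) = if j = i ∧ k = 0 then 1 else 0)
    {W : AddSubgroup M} (hEW : ∀ i, E i ∈ W) (hTW : ∀ f ∈ W, (T (-1) : ℤ[T;T⁻¹]) • f ∈ W)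
    {V : Submodule ℤ[T;T⁻¹] M} (hEV : ∀ i, E i ∈ V)
    (hker : ∀ f ∈ W, (∀ j (k : ℕ), D j ((T k : ℤ[T;T⁻¹]) • f) = 0) → f ∈ V) (K : ℕ) :
    ∀ f ∈ W, (∀ k : ℕ, K ≤ k → ∀ j, D j ((T k : ℤ[T;T⁻¹]) • f) = 0) → f ∈ V := by
  have hTneg : ∀ k : ℕ, ∀ g ∈ W, (T (-k) : ℤ[T;T⁻¹]) • g ∈ W := by
    intro k g hg
    induction k with
    | zero => simpa
    | succ k ih =>
      rw [show (-((k + 1 : ℕ) : ℤ)) = -1 + -k by push_cast; ring, T_add, mul_smul]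
      exact hTW _ ih
  induction K with
  | zero => exact fun f hf hk => hker f hf fun j k => hk k (Nat.zero_le _) j
  | succ K ih =>
    intro f hf hk
    set q : M := ∑ i, (D i ((T K : ℤ[T;T⁻¹]) • f)) • (T (-K) : ℤ[T;T⁻¹]) • E i with hq
    have hqW : q ∈ W := W.sum_mem fun i _ => W.zsmul_mem (hTneg _ _ (hEW i)) _
    have hqV : q ∈ V :=
      Submodule.sum_mem _ fun i _ => zsmul_mem (Submodule.smul_mem _ _ (hEV i)) _
    have hDq : ∀ k : ℕ, K ≤ k → ∀ j,
        D j ((T k : ℤ[T;T⁻¹]) • q) = if k = K then D j ((T K : ℤ[T;T⁻¹]) • f) else 0 := by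
      intro k hkK j
      have : ∀ i, D j ((T k : ℤ[T;T⁻¹]) • (D i ((T K : ℤ[T;T⁻¹]) • f)) •
          (T (-K) : ℤ[T;T⁻¹]) • E i) =
          if j = i then if k = K then D j ((T K : ℤ[T;T⁻¹]) • f) else 0 else 0 := by
        intro i
        -- As `K ≤ k`, the combined exponent is a natural number, so `hDE` applies.
        rw [smul_comm, smul_smul, ← T_add, map_zsmul,
          show (k : ℤ) + -K = ((k - K : ℕ) : ℤ) by omega, hDE]
        by_cases h1 : j = i
        · subst h1
          by_cases h2 : k = K
          · subst h2; simp
          · rw [if_neg fun h => h2 (by omega), if_pos rfl, if_neg h2, smul_zero]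
        · rw [if_neg fun h => h1 h.1, if_neg h1, smul_zero]
      rw [hq, Finset.smul_sum, map_sum, Finset.sum_congr rfl fun i _ => this i,
        Finset.sum_ite_eq, if_pos (Finset.mem_univ _)]
    have := ih (f - q) (W.sub_mem hf hqW) fun k hkK j => by
      rw [smul_sub, map_sub, hDq k hkK]
      split_ifs with h
      · rw [h, sub_self]
      · rw [hk k (by omega), sub_zero]
    rw [← sub_add_cancel f q]
    exact add_mem this hqV

/-- A criterion for a `ℤ[t,t⁻¹]`-module to be the direct sum of a free module with basis `E` and a copy
of `ℤ` generated by the fixed point `u` of `t`: there are functionals `D j` which detect the coefficient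
of `E j`, on combinations of the `tᵏ E i` with `k ≥ 0`, and every element is moved by negative powers of
`t` to a subgroup `W` in which the functionals `D j ∘ tᵏ`, `k ≥ 0`, determine everything up to
multiples of `u`. -/
theorem nonempty_linearEquiv_of_functionals 
    (W : AddSubgroup M)
    (hu : (T 1 : ℤ[T;T⁻¹]) • u = u) (hu0 : ∀ c : ℤ, c • u = 0 → c = 0) (hDu : ∀ j, D j u = 0)
    (hDE : ∀ j i (k : ℕ), D j ((T k : ℤ[T;T⁻¹]) • E i) = if j = i ∧ k = 0 then 1 else 0)
    (hD : ∀ f, ∃ K : ℕ, ∀ k : ℕ, K ≤ k → ∀ j, D j ((T k : ℤ[T;T⁻¹]) • f) = 0)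
    (hEW : ∀ i, E i ∈ W) (hTW : ∀ f ∈ W, (T (-1) : ℤ[T;T⁻¹]) • f ∈ W)
    (hW : ∀ f, ∃ N : ℕ, (T (-N) : ℤ[T;T⁻¹]) • f ∈ W)
    (hker : ∀ f ∈ W, (∀ j (k : ℕ), D j ((T k : ℤ[T;T⁻¹]) • f) = 0) → ∃ c : ℤ, f = c • u) :
    Nonempty (M ≃ₗ[ℤ[T;T⁻¹]] (Fin m → ℤ[T;T⁻¹]) × TrivialInt) := by
  let Φ := (Fintype.linearCombination ℤ[T;T⁻¹] E).coprod (TrivialInt.toModule u hu)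
  have hΦ : ∀ (p : Fin m → ℤ[T;T⁻¹]) (c : ℤ), Φ (p, c) = ∑ i, p i • E i + c • u := fun p c => by
    simp only [Φ, LinearMap.coprod_apply, Fintype.linearCombination_apply]; rfl
  refine ⟨(LinearEquiv.ofBijective Φ ⟨?_, ?_⟩).symm⟩
  · rw [← LinearMap.ker_eq_bot, LinearMap.ker_eq_bot']
    rintro ⟨p, c⟩ h0
    have h0' : ∑ i, p i • E i + (show ℤ from c) • u = 0 := (hΦ p c).symm.trans h0
    have hp := eq_zero_of_sum_smul_eq_zero hu hDu hDE p _ h0'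
    subst hp
    simp only [Pi.zero_apply, zero_smul, Finset.sum_const_zero, zero_add] at h0'
    exact Prod.ext rfl (hu0 _ h0')
  · intro f
    have hEV : ∀ i, E i ∈ LinearMap.range Φ := fun i => ⟨(Pi.single i 1, (0 : ℤ)), by
      rw [hΦ, zero_smul, add_zero, Finset.sum_eq_single i]
      · rw [Pi.single_eq_same, one_smul]
      · intro j _ hj
        rw [Pi.single_eq_of_ne hj, zero_smul]
      · exact fun h => absurd (Finset.mem_univ _) h⟩
    have hV : ∀ f ∈ W, (∀ j (k : ℕ), D j ((T k : ℤ[T;T⁻¹]) • f) = 0) → f ∈ LinearMap.range Φ := by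
      intro f hf hk
      obtain ⟨c, rfl⟩ := hker f hf hk
      exact ⟨(0, c), by
        rw [hΦ]
        simp only [Pi.zero_apply, zero_smul, Finset.sum_const_zero, zero_add]⟩
    -- Surjectivity may be checked after a shift into `W`, since the range is a submodule and `tᴺ`
    -- undoes the shift.
    obtain ⟨N, hN⟩ := hW f
    obtain ⟨K, hK⟩ := hD ((T (-N) : ℤ[T;T⁻¹]) • f)
    have := Submodule.smul_mem _ (T N : ℤ[T;T⁻¹])
      (mem_span_of_functionals hDE hEW hTW hEV hV K _ hN hK)
    rwa [smul_smul, ← T_add, add_neg_cancel, T_zero, one_smul] at this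

end Functionals

end LaurentModule

/-- Fibres over the image are singletons, so the transfer map is composition with the inverse of `σ`
there. -/
lemma transfer_apply_map {X : Type*} [TopologicalSpace X] {σ : X → X} (h : IsPiecewiseHomeo σ)
    (hσ : Function.Injective σ) (f : C(X, ℤ)) (x : X) : transfer h f (σ x) = f x := by
  change ∑ᶠ y ∈ σ ⁻¹' {σ x}, f y = f x
  have : σ ⁻¹' {σ x} = {x} := by
    ext y; exact hσ.eq_iff
  rw [this, finsum_mem_singleton]

/-! ### Jumps of continuous integer-valued functions on the disconnection. -/

namespace Disconnection

variable {S : Set unitInterval}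

lemma lift_eq_lift_of_notMem {x : unitInterval} (hx : ¬ (x ∈ S ∧ x ≠ 0 ∧ x ≠ 1)) (b b' : Bool) :
    lift S x b = lift S x b' := by
  unfold lift; rw [dif_neg hx, dif_neg hx]

/-- A continuous integer-valued function is constant on an order interval starting at `x⁺`, and such
an interval contains both points above every `y` slightly larger than `x`. -/
lemma eventually_nhdsGT (f : C(Disconnection S, ℤ)) (x : unitInterval) :
    ∀ᶠ y in 𝓝[>] x, ∀ b, f (lift S y b) = f (lift S x true) := by
  rcases eq_or_lt_of_le (unitInterval.le_one' : x ≤ 1) with rfl | hx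
  · have : Ioi (1 : unitInterval) = ∅ := by
      ext z; simpa using (unitInterval.le_one' : z ≤ 1)
    simp [this]
  have hs : f ⁻¹' {f (lift S x true)} ∈ 𝓝[≥] (lift S x true) :=
    mem_nhdsWithin_of_mem_nhds (((isOpen_discrete _).preimage f.continuous).mem_nhds rfl)
  have h1 : lift S x true < lift S 1 false := (lift_lt_lift _ _ _ _).2 (Or.inl hx)
  obtain ⟨u, hu, hsub⟩ := (mem_nhdsGE_iff_exists_Ico_subset' h1).1 hs
  rw [mem_Ioi, ← lift_side u, lift_lt_lift] at hu
  have hu : x < u.pt := by simpa using hu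
  filter_upwards [Ioo_mem_nhdsGT hu] with y hy b
  refine hsub ⟨((lift_lt_lift _ _ _ _).2 (Or.inl hy.1)).le, ?_⟩
  rw [← lift_side u, lift_lt_lift]
  exact Or.inl hy.2

lemma eventually_nhdsLT (f : C(Disconnection S, ℤ)) (x : unitInterval) :
    ∀ᶠ y in 𝓝[<] x, ∀ b, f (lift S y b) = f (lift S x false) := by
  rcases eq_or_lt_of_le (unitInterval.nonneg' : 0 ≤ x) with rfl | hx
  · have : Iio (0 : unitInterval) = ∅ := by
      ext z; simp
    simp [this]
  have hs : f ⁻¹' {f (lift S x false)} ∈ 𝓝[≤] (lift S x false) :=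
    mem_nhdsWithin_of_mem_nhds (((isOpen_discrete _).preimage f.continuous).mem_nhds rfl)
  have h1 : lift S 0 true < lift S x false := (lift_lt_lift _ _ _ _).2 (Or.inl hx)
  obtain ⟨u, hu, hsub⟩ := (mem_nhdsLE_iff_exists_Ioc_subset' h1).1 hs
  rw [mem_Iio, ← lift_side u, lift_lt_lift] at hu
  have hu : u.pt < x := by simpa using hu
  filter_upwards [Ioo_mem_nhdsLT hu] with y hy b
  refine hsub ⟨?_, ((lift_lt_lift _ _ _ _).2 (Or.inl hy.2)).le⟩
  rw [← lift_side u, lift_lt_lift]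
  exact Or.inl hy.1

/-- The jump `f(x⁺) - f(x⁻)`, which is zero at the points which are not doubled. -/
noncomputable def jump (x : unitInterval) : C(Disconnection S, ℤ) →+ ℤ where
  toFun f := f (lift S x true) - f (lift S x false)
  map_zero' := by simp
  map_add' f g := by simp only [ContinuousMap.add_apply]; ring

lemma jump_apply (x : unitInterval) (f : C(Disconnection S, ℤ)) :
    jump x f = f (lift S x true) - f (lift S x false) := rfl

lemma mem_of_jump_ne_zero {x : unitInterval} {f : C(Disconnection S, ℤ)} (h : jump x f ≠ 0) :
    x ∈ S ∧ x ≠ 0 ∧ x ≠ 1 := by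
  by_contra hx
  exact h (by rw [jump_apply, lift_eq_lift_of_notMem hx true false, sub_self])

/-- Each `x` has a neighbourhood with no jump except possibly at `x` itself; compactness of the
interval leaves finitely many. -/
lemma finite_jumps (f : C(Disconnection S, ℤ)) : {x | jump x f ≠ 0}.Finite := by
  have h : ∀ x : unitInterval, ∃ U ∈ 𝓝 x, ∀ y ∈ U, y ≠ x → jump y f = 0 := by
    intro x
    have h1 := (eventually_nhdsGT f x).and self_mem_nhdsWithin
    have h2 := (eventually_nhdsLT f x).and self_mem_nhdsWithin
    refine ⟨{y | y ≠ x → jump y f = 0}, ?_, fun y hy => hy⟩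
    change ∀ᶠ y in 𝓝 x, y ≠ x → jump y f = 0
    refine eventually_nhdsWithin_iff.1 (?_ : ∀ᶠ y in 𝓝[≠] x, jump y f = 0)
    rw [← Iio_union_Ioi, nhdsWithin_union, eventually_sup]
    constructor
    · filter_upwards [h2] with y hy
      rw [jump_apply, hy.1, hy.1, sub_self]
    · filter_upwards [h1] with y hy
      rw [jump_apply, hy.1, hy.1, sub_self]
  choose U hU hU' using h
  obtain ⟨t, -, ht⟩ := isCompact_univ.elim_nhds_subcover U fun x _ => hU x
  refine t.finite_toSet.subset fun x hx => ?_
  obtain ⟨z, hz, hxz⟩ := mem_iUnion₂.1 (ht (mem_univ x))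
  by_cases e : x = z
  · rwa [e]
  · exact absurd (hU' z x hxz e) hx

/-- Without jumps, `f` descends to a locally constant function on the connected interval. -/
lemma eq_const_of_jump_eq_zero (f : C(Disconnection S, ℤ)) (hf : ∀ x, jump x f = 0) :
    ∃ c : ℤ, ∀ p, f p = c := by
  have hb : ∀ x b, f (lift S x b) = f (lift S x true) := by
    intro x b
    cases b
    · exact (sub_eq_zero.1 (hf x)).symm
    · rfl
  have hlc : IsLocallyConstant fun x => f (lift S x true) := by
    rw [IsLocallyConstant.iff_eventually_eq]
    intro x
    have h1 := eventually_nhdsGT f x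
    have h2 := eventually_nhdsLT f x
    rw [← nhdsNE_sup_pure, ← Iio_union_Ioi, nhdsWithin_union, eventually_sup, eventually_sup]
    refine ⟨⟨?_, ?_⟩, rfl⟩
    · filter_upwards [h2] with y hy
      rw [hy, hb]
    · filter_upwards [h1] with y hy
      exact hy _
  refine ⟨f (lift S 0 true), fun p => ?_⟩
  rw [← lift_side p, hb]
  exact hlc.apply_eq_of_isPreconnected isPreconnected_univ (mem_univ _) (mem_univ _)

/-- The indicator function of the points to the right of the cut at `c`. -/
noncomputable def step (c : unitInterval) (hc : c ∈ S ∧ c ≠ 0 ∧ c ≠ 1) (h1 : (1 : unitInterval) ∈ S) :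
    C(Disconnection S, ℤ) :=
  ⟨(Icc (lift S c true) (lift S 1 false)).indicator 1,
    continuous_one.indicator fun p hp => by
      rw [(isClopen_Icc hc.1 h1 (lt_of_le_of_ne unitInterval.le_one' hc.2.2)).frontier_eq] at hp
      exact hp.elim⟩

lemma jump_step (c : unitInterval) (hc : c ∈ S ∧ c ≠ 0 ∧ c ≠ 1) (h1 : (1 : unitInterval) ∈ S)
    (x : unitInterval) : jump x (step c hc h1) = if x = c then 1 else 0 := by
  classical
  have hx : ∀ b, lift S x b ≤ lift S 1 false := fun b => by
    rw [lift_le_lift]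
    rcases eq_or_lt_of_le (unitInterval.le_one' : x ≤ 1) with h | h
    · exact Or.inr ⟨h, Or.inr (Or.inr fun h' => h'.2.2 h)⟩
    · exact Or.inl h
  have e : ∀ b, step c hc h1 (lift S x b) = if c < x ∨ c = x ∧ b = true then 1 else 0 := by
    intro b
    change (Icc (lift S c true) (lift S 1 false)).indicator 1 (lift S x b) = _
    simp [indicator_apply, mem_Icc, hx b, lift_le_lift, hc]
  rw [jump_apply, e, e]
  rcases lt_trichotomy x c with h | rfl | h
  · simp [h.not_gt, h.ne, h.ne']
  · simp
  · simp [h, h.ne']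

end Disconnection

/-! ### Images of the intervals of monotonicity, injectivity of `σ`, and jumps under pullback. -/

namespace IsPiecewiseMonotonic

variable {n : ℕ} {τ : unitInterval → unitInterval} {a : Fin (n + 1) → unitInterval}

/-- The left endpoint of the image of the `i`-th interval. -/
noncomputable def lo (τ : unitInterval → unitInterval) (a : Fin (n + 1) → unitInterval)
    (i : Fin n) : unitInterval :=
  if flip τ a i then branch τ a i (a i.succ) else branch τ a i (a i.castSucc)

/-- The right endpoint of the image of the `i`-th interval. -/
noncomputable def hi (τ : unitInterval → unitInterval) (a : Fin (n + 1) → unitInterval)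
    (i : Fin n) : unitInterval :=
  if flip τ a i then branch τ a i (a i.castSucc) else branch τ a i (a i.succ)

lemma image_branch_Icc (h : IsPiecewiseMonotonic τ a) (i : Fin n) :
    branch τ a i '' Icc (a i.castSucc) (a i.succ) = Icc (lo τ a i) (hi τ a i) := by
  have hm := h.branch_monotonic i
  have h1 : a i.castSucc ∈ Icc (a i.castSucc) (a i.succ) := ⟨le_rfl, (h.lt i).le⟩
  have h2 : a i.succ ∈ Icc (a i.castSucc) (a i.succ) := ⟨(h.lt i).le, le_rfl⟩
  apply Subset.antisymm
  · rintro _ ⟨x, hx, rfl⟩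
    unfold lo hi
    split_ifs at * with hf
    · exact ⟨hm.antitoneOn hx h2 hx.2, hm.antitoneOn h1 hx hx.1⟩
    · exact ⟨hm.monotoneOn h1 hx hx.1, hm.monotoneOn hx h2 hx.2⟩
  · unfold lo hi
    split_ifs with hf
    · exact intermediate_value_Icc' (h.lt i).le (h.continuousOn_branch i)
    · exact intermediate_value_Icc (h.lt i).le (h.continuousOn_branch i)

lemma image_Ioo (h : IsPiecewiseMonotonic τ a) (i : Fin n) :
    τ '' Ioo (a i.castSucc) (a i.succ) = Ioo (lo τ a i) (hi τ a i) := by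
  have hm := h.branch_monotonic i
  have h1 : a i.castSucc ∈ Icc (a i.castSucc) (a i.succ) := ⟨le_rfl, (h.lt i).le⟩
  have h2 : a i.succ ∈ Icc (a i.castSucc) (a i.succ) := ⟨(h.lt i).le, le_rfl⟩
  apply Subset.antisymm
  · rintro _ ⟨x, hx, rfl⟩
    rw [← h.branch_eq i hx]
    have hx' := Ioo_subset_Icc_self hx
    unfold lo hi
    split_ifs at * with hf
    · exact ⟨hm hx' h2 hx.2, hm h1 hx' hx.1⟩
    · exact ⟨hm h1 hx' hx.1, hm hx' h2 hx.2⟩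
  · intro y hy
    have hy' := Ioo_subset_Icc_self hy
    rw [← h.image_branch_Icc i] at hy'
    obtain ⟨x, hx, rfl⟩ := hy'
    have hx' : x ∈ Ioo (a i.castSucc) (a i.succ) := by
      refine ⟨lt_of_le_of_ne hx.1 ?_, lt_of_le_of_ne hx.2 ?_⟩
      · rintro rfl
        unfold lo hi at hy
        split_ifs at hy
        · exact lt_irrefl _ hy.2
        · exact lt_irrefl _ hy.1
      · rintro rfl
        unfold lo hi at hy
        split_ifs at hy
        · exact lt_irrefl _ hy.1
        · exact lt_irrefl _ hy.2
    exact ⟨x, hx', (h.branch_eq i hx').symm⟩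

lemma lo_lt_hi (h : IsPiecewiseMonotonic τ a) (i : Fin n) : lo τ a i < hi τ a i :=
  h.endpoints_lt i

lemma index_unique (h : IsPiecewiseMonotonic τ a) {i j : Fin n} {x : unitInterval}
    (hi : x ∈ Ioo (a i.castSucc) (a i.succ)) (hj : x ∈ Icc (a j.castSucc) (a j.succ)) : i = j := by
  rcases lt_trichotomy i j with hij | hij | hij
  · have : a i.succ ≤ a j.castSucc := h.strictMono.monotone (by simpa [Fin.le_def] using hij)
    exact absurd (hi.2.trans_le (this.trans hj.1)) (lt_irrefl _)
  · exact hij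
  · have : a j.succ ≤ a i.castSucc := h.strictMono.monotone (by simpa [Fin.le_def] using hij)
    exact absurd (hi.1.trans_le (hj.2.trans this)) (lt_irrefl _)

lemma exists_mem_Ioo (h : IsPiecewiseMonotonic τ a) {x : unitInterval} (hx : x ∉ range a) :
    ∃ i : Fin n, x ∈ Ioo (a i.castSucc) (a i.succ) := by
  obtain ⟨i, hi⟩ := h.exists_mem_Ioc (x := x) fun e => hx ⟨0, h.first.trans e.symm⟩
  exact ⟨i, hi.1, lt_of_le_of_ne hi.2 fun e => hx ⟨_, e.symm⟩⟩

lemma oneSidedLimits_eq (h : IsPiecewiseMonotonic τ a) {x : unitInterval} (hx : x ∉ range a) :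
    oneSidedLimits τ x = {τ x} := by
  obtain ⟨i, hi⟩ := h.exists_mem_Ioo hx
  refine Subset.antisymm (fun y hy => ?_) (singleton_subset_iff.2 ?_)
  · obtain ⟨j, hj, rfl⟩ := h.exists_branch_eq hy
    obtain rfl := h.index_unique hi hj
    exact h.branch_eq i hi
  · rw [← h.branch_eq i hi]
    exact h.branch_mem i (Ioo_subset_Icc_self hi)

lemma map_ne_zero_one (h : IsPiecewiseMonotonic τ a) {x : unitInterval} (hx : x ∉ range a) :
    τ x ≠ 0 ∧ τ x ≠ 1 := by
  obtain ⟨i, hi⟩ := h.exists_mem_Ioo hx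
  have : τ x ∈ Ioo (lo τ a i) (IsPiecewiseMonotonic.hi τ a i) := h.image_Ioo i ▸ mem_image_of_mem τ hi
  exact ⟨(unitInterval.nonneg'.trans_lt this.1).ne', (this.2.trans_le unitInterval.le_one').ne⟩

/-- If two images overlapped, the overlap would be a nondegenerate interval, and its preimages in
the two pieces would be disjoint intervals with the same image. -/
lemma disjoint_images (h : IsPiecewiseMonotonic τ a) (hinj : IsEssentiallyInjective τ)
    {i j : Fin n} (hij : i ≠ j) :
    Disjoint (Ioo (lo τ a i) (hi τ a i)) (Ioo (lo τ a j) (hi τ a j)) := by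
  rw [disjoint_iff_inter_eq_empty, Ioo_inter_Ioo, Ioo_eq_empty_iff]
  intro hlt
  set u := lo τ a i ⊔ lo τ a j
  set v := hi τ a i ⊓ hi τ a j
  have hnt : (Ioo u v).Nontrivial := by
    obtain ⟨x, hux, hxv⟩ := exists_between hlt
    obtain ⟨y, hxy, hyv⟩ := exists_between hxv
    exact ⟨x, ⟨hux, hxv⟩, y, ⟨hux.trans hxy, hyv⟩, hxy.ne⟩
  have key : ∀ k, lo τ a k ≤ u → v ≤ hi τ a k →
      τ '' (Ioo (a k.castSucc) (a k.succ) ∩ τ ⁻¹' Ioo u v) = Ioo u v ∧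
      (Ioo (a k.castSucc) (a k.succ) ∩ τ ⁻¹' Ioo u v).OrdConnected := by
    intro k h1 h2
    constructor
    · rw [image_inter_preimage, h.image_Ioo k, inter_eq_right]
      exact Ioo_subset_Ioo h1 h2
    · refine ⟨fun x hx y hy z hz => ?_⟩
      have hz' : z ∈ Ioo (a k.castSucc) (a k.succ) :=
        ⟨hx.1.1.trans_le hz.1, hz.2.trans_lt hy.1.2⟩
      refine ⟨hz', ?_⟩
      rcases h.monotonic k with hm | hm
      · exact ⟨hx.2.1.trans_le (hm.monotoneOn hx.1 hz' hz.1),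
          (hm.monotoneOn hz' hy.1 hz.2).trans_lt hy.2.2⟩
      · exact ⟨hy.2.1.trans_le (hm.antitoneOn hz' hy.1 hz.2),
          (hm.antitoneOn hx.1 hz' hz.1).trans_lt hx.2.2⟩
  obtain ⟨ei, oi⟩ := key i le_sup_left inf_le_left
  obtain ⟨ej, oj⟩ := key j le_sup_right inf_le_right
  refine hinj ⟨_, _, oi, nontrivial_of_image τ _ (by rwa [ei]), oj, nontrivial_of_image τ _ (by rwa [ej]),
    ?_, ei.trans ej.symm⟩
  exact disjoint_left.2 fun x hx hx' => hij (h.index_unique hx.1 (Ioo_subset_Icc_self hx'.1))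

/-- The value `τ z` is interior to the image of its piece. It cannot lie in the closed image of
another piece, since the open images would then meet; within one piece the branch is injective. So
going backwards is unambiguous away from the partition. -/
lemma eq_of_mem_oneSidedLimits (h : IsPiecewiseMonotonic τ a) (hinj : IsEssentiallyInjective τ)
    {z w : unitInterval} (hz : z ∉ range a) (hw : τ z ∈ oneSidedLimits τ w) : w = z := by
  obtain ⟨i, hzi⟩ := h.exists_mem_Ioo hz
  obtain ⟨j, hwj, e⟩ := h.exists_branch_eq hw
  by_cases hij : i = j
  · subst hij
    have hinjOn : InjOn (branch τ a i) (Icc (a i.castSucc) (a i.succ)) := by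
      have := h.branch_monotonic i
      split_ifs at this
      · exact this.injOn
      · exact this.injOn
    exact hinjOn hwj (Ioo_subset_Icc_self hzi) (e.trans (h.branch_eq i hzi).symm)
  · exfalso
    have hd := h.disjoint_images hinj hij
    rw [disjoint_iff_inter_eq_empty, Ioo_inter_Ioo, Ioo_eq_empty_iff] at hd
    have h1 : τ z ∈ Ioo (lo τ a i) (hi τ a i) := h.image_Ioo i ▸ mem_image_of_mem τ hzi
    have h2 : τ z ∈ Icc (lo τ a j) (hi τ a j) := by
      rw [← h.image_branch_Icc j, ← e]; exact mem_image_of_mem _ hwj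
    have h3 := h.lo_lt_hi j
    have h4 := h.lo_lt_hi i
    refine hd ?_
    rw [sup_lt_iff, lt_inf_iff, lt_inf_iff]
    exact ⟨⟨h4, h1.1.trans_le h2.2⟩, h2.1.trans_lt h1.2, h3⟩

lemma localHomeo_injective (h : IsPiecewiseMonotonic τ a) (hinj : IsEssentiallyInjective τ) :
    Function.Injective h.localHomeo := by
  intro p q hpq
  obtain ⟨i, hp⟩ := h.exists_mem_piece p
  obtain ⟨j, hq⟩ := h.exists_mem_piece q
  by_cases hij : i = j
  · subst hij
    rcases h.localHomeo_monotonic i with hm | hm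
    · exact hm.injOn hp hq hpq
    · exact hm.injOn hp hq hpq
  · exfalso
    have hd := h.disjoint_images hinj hij
    rw [disjoint_iff_inter_eq_empty, Ioo_inter_Ioo, Ioo_eq_empty_iff] at hd
    have hp' := mem_image_of_mem h.localHomeo hp
    have hq' := mem_image_of_mem h.localHomeo hq
    rw [← hpq] at hq'
    rw [h.image_piece, Disconnection.mem_Icc_lift (h.endpoints_mem _).1 (h.endpoints_mem _).2
      (h.endpoints_lt _)] at hp' hq'
    change (_ ∧ _ ∈ Ico (lo τ a _) (hi τ a _)) ∨ (_ ∧ _ ∈ Ioc (lo τ a _) (hi τ a _)) at hp' hq'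
    have h3 := h.lo_lt_hi j
    have h4 := h.lo_lt_hi i
    refine hd ?_
    rw [sup_lt_iff, lt_inf_iff, lt_inf_iff]
    -- A common image point has a single side, so two half-open intervals of the same kind meet, and
    -- hence so do their interiors.
    rcases hp' with ⟨s, hp'⟩ | ⟨s, hp'⟩ <;> rcases hq' with ⟨s', hq'⟩ | ⟨s', hq'⟩
    · exact ⟨⟨h4, hp'.1.trans_lt hq'.2⟩, hq'.1.trans_lt hp'.2, h3⟩
    · rw [s] at s'; exact absurd s' (by simp)
    · rw [s] at s'; exact absurd s' (by simp)
    · exact ⟨⟨h4, hp'.1.trans_le hq'.2⟩, hq'.1.trans_le hp'.2, h3⟩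

/-- The map `f ↦ f ∘ σ`. -/
noncomputable def pullback (h : IsPiecewiseMonotonic τ a) (f : C(Disconnection (cuts τ a), ℤ)) :
    C(Disconnection (cuts τ a), ℤ) :=
  f.comp ⟨h.localHomeo, h.isPiecewiseHomeo.continuous⟩

lemma pullback_transfer (h : IsPiecewiseMonotonic τ a) (hinj : IsEssentiallyInjective τ)
    (f : C(Disconnection (cuts τ a), ℤ)) : h.pullback (transfer h.isPiecewiseHomeo f) = f := by
  ext x
  exact transfer_apply_map h.isPiecewiseHomeo (h.localHomeo_injective hinj) f x

/-- Near `x` the map `σ` preserves the two sides if `τ` increases and exchanges them if it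
decreases, whence the sign. At a partition point the two sides lie in different pieces and no such
relation is available. -/
lemma jump_pullback (h : IsPiecewiseMonotonic τ a) {x : unitInterval} (hx : x ∉ range a)
    (f : C(Disconnection (cuts τ a), ℤ)) :
    Disconnection.jump x (h.pullback f) = Disconnection.jump (τ x) f ∨
      Disconnection.jump x (h.pullback f) = -Disconnection.jump (τ x) f := by
  have hmem : τ x ∈ oneSidedLimits τ x := by rw [h.oneSidedLimits_eq hx]; rfl
  have hiff : τ x ∈ cuts τ a ↔ x ∈ cuts τ a := mem_generalizedOrbit_iff hmem
  by_cases hxS : x ∈ cuts τ a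
  · obtain ⟨i, hi⟩ := h.exists_mem_Ioo hx
    have hx0 : x ≠ 0 := fun e => hx ⟨0, h.first.trans e.symm⟩
    have hx1 : x ≠ 1 := fun e => hx ⟨_, h.last.trans e.symm⟩
    have key : ∀ b, h.pullback f (Disconnection.lift _ x b) =
        f (Disconnection.lift _ (τ x) (xor (flip τ a i) b)) := by
      intro b
      have hs := Disconnection.lift_pt_side (b := b) hxS (fun e => absurd e hx0)
        fun e => absurd e hx1
      have hp : Disconnection.lift _ x b ∈ piece τ a i := by
        rw [h.mem_piece, hs, Disconnection.lift_pt]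
        cases b
        · exact Or.inr ⟨rfl, Ioo_subset_Ioc_self hi⟩
        · exact Or.inl ⟨rfl, Ioo_subset_Ico_self hi⟩
      change f (h.localHomeo _) = _
      rw [h.localHomeo_eq hp, hs, Disconnection.lift_pt, h.branch_eq i hi]
    simp only [Disconnection.jump_apply, key]
    cases flip τ a i <;> simp
  · left
    have h1 : Disconnection.jump x (h.pullback f) = 0 := by
      by_contra h0; exact hxS (Disconnection.mem_of_jump_ne_zero h0).1
    have h2 : Disconnection.jump (τ x) f = 0 := by
      by_contra h0; exact hxS (hiff.1 (Disconnection.mem_of_jump_ne_zero h0).1)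
    rw [h1, h2]

lemma jump_pullback_eq_zero_iff (h : IsPiecewiseMonotonic τ a) {x : unitInterval}
    (hx : x ∉ range a) (f : C(Disconnection (cuts τ a), ℤ)) :
    Disconnection.jump x (h.pullback f) = 0 ↔ Disconnection.jump (τ x) f = 0 := by
  rcases h.jump_pullback hx f with e | e <;> rw [e]
  exact neg_eq_zero

/-! ### Backward orbits that avoid the partition. -/

/-- A point outside the forward orbit of the limits at the partition has an infinite backward orbit
which avoids the partition. -/
lemma exists_backward_orbit (h : IsPiecewiseMonotonic τ a) (hs : IsHatSurjective τ)
    {c : unitInterval} (hc : c ∉ hatOrbit τ (hatImage τ (range a))) :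
    ∃ β : ℕ → unitInterval, β 0 = c ∧ ∀ k, β (k + 1) ∉ range a ∧ τ (β (k + 1)) = β k := by
  have hpre : ∀ y, y ∉ hatOrbit τ (hatImage τ (range a)) →
      ∃ x, x ∉ hatOrbit τ (hatImage τ (range a)) ∧ x ∉ range a ∧ τ x = y := by
    intro y hy
    obtain ⟨x, -, hx⟩ := mem_iUnion₂.1 (hs.symm ▸ mem_univ y : y ∈ hatImage τ univ)
    have hxa : x ∉ range a := fun hxa =>
      hy (mem_iUnion.2 ⟨0, mem_iUnion₂.2 ⟨x, hxa, hx⟩⟩)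
    refine ⟨x, fun hx' => ?_, hxa, ?_⟩
    · obtain ⟨k, hk⟩ := mem_iUnion.1 hx'
      refine hy (mem_iUnion.2 ⟨k + 1, ?_⟩)
      rw [Function.iterate_succ_apply']
      exact mem_iUnion₂.2 ⟨x, hk, hx⟩
    · rw [h.oneSidedLimits_eq hxa] at hx
      exact hx.symm
  choose! g hg1 hg2 hg3 using hpre
  have hmem : ∀ k, g^[k] c ∉ hatOrbit τ (hatImage τ (range a)) := by
    intro k
    induction k with
    | zero => exact hc
    | succ k ih => rw [Function.iterate_succ_apply']; exact hg1 _ ih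
  refine ⟨fun k => g^[k] c, rfl, fun k => ?_⟩
  simp only [Function.iterate_succ_apply']
  exact ⟨hg2 _ (hmem k), hg3 _ (hmem k)⟩

lemma iterate_backward {β : ℕ → unitInterval} (hβ : ∀ k, τ (β (k + 1)) = β k) (k l : ℕ) :
    τ^[k] (β (l + k)) = β l := by
  induction k with
  | zero => rfl
  | succ k ih => rw [Function.iterate_succ_apply, ← add_assoc, hβ, ih]

lemma backward_injective {β : ℕ → unitInterval} (h0 : β 0 ∈ range a)
    (hβ : ∀ k, β (k + 1) ∉ range a ∧ τ (β (k + 1)) = β k) : Function.Injective β := by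
  intro k l hkl
  by_contra hne
  wlog hlt : k < l generalizing k l
  · exact this hkl.symm (Ne.symm hne) (lt_of_le_of_ne (not_lt.1 hlt) (Ne.symm hne))
  obtain ⟨d, rfl⟩ := Nat.exists_eq_add_of_lt hlt
  -- Applying `τᵏ` to a coincidence `β k = β (k + d + 1)` gives `β 0 = β (d + 1)`, which would
  -- return to the partition.
  have h1 := iterate_backward (fun k => (hβ k).2) k 0
  have h2 := iterate_backward (fun k => (hβ k).2) k (d + 1)
  rw [zero_add, hkl, show k + d + 1 = d + 1 + k by ring, h2] at h1
  exact (hβ d).1 (h1 ▸ h0)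

/-! ### Pulling all jumps back into a set `B` that contains the interior partition points. -/

section BackwardSet

variable {B : Set unitInterval}

/-- The right-hand side contains the partition and is closed under `τ̂` and `τ̂⁻¹`. For preimages
off the partition, uniqueness of the preimage lowers the level in the forward orbit by one. -/
lemma cuts_subset (h : IsPiecewiseMonotonic τ a) (hinj : IsEssentiallyInjective τ)
    (hB : range a \ {0, 1} ⊆ B) (hB' : ∀ x ∉ range a, τ x ∈ B → x ∈ B)
    (hBf : ∀ x ∈ B, x ∉ range a → τ x ∈ B) : cuts τ a ⊆ B ∪ hatOrbit τ (range a) := by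
  refine sInter_subset_of_mem ⟨fun x hx => Or.inr (mem_iUnion.2 ⟨0, hx⟩), ?_, ?_⟩
  · intro y hy
    obtain ⟨x, hx, hxy⟩ := mem_iUnion₂.1 hy
    by_cases hxa : x ∈ range a
    · exact Or.inr (mem_iUnion.2 ⟨1, mem_iUnion₂.2 ⟨x, hxa, hxy⟩⟩)
    rcases hx with hx | hx
    · rw [h.oneSidedLimits_eq hxa] at hxy
      rw [mem_singleton_iff.1 hxy]
      exact Or.inl (hBf x hx hxa)
    · obtain ⟨k, hk⟩ := mem_iUnion.1 hx
      refine Or.inr (mem_iUnion.2 ⟨k + 1, ?_⟩)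
      rw [Function.iterate_succ_apply']
      exact mem_iUnion₂.2 ⟨x, hk, hxy⟩
  · rintro x ⟨y, hxy, hy⟩
    by_cases hxa : x ∈ range a
    · exact Or.inr (mem_iUnion.2 ⟨0, hxa⟩)
    rw [h.oneSidedLimits_eq hxa] at hxy
    obtain rfl := mem_singleton_iff.1 hxy
    rcases hy with hy | hy
    · exact Or.inl (hB' x hxa hy)
    · obtain ⟨k, hk⟩ := mem_iUnion.1 hy
      cases k with
      | zero =>
        -- At level zero `τ x` is a partition point; being interior to an image interval it is
        -- neither `0` nor `1`, so it belongs to `B`.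
        obtain ⟨h0, h1⟩ := h.map_ne_zero_one hxa
        exact Or.inl (hB' x hxa (hB ⟨hk, by simp [h0, h1]⟩))
      | succ k =>
        rw [Function.iterate_succ_apply'] at hk
        obtain ⟨w, hw, hwx⟩ := mem_iUnion₂.1 hk
        obtain rfl := h.eq_of_mem_oneSidedLimits hinj hxa hwx
        exact Or.inr (mem_iUnion.2 ⟨k, hw⟩)

/-- Backward steps from `τᴺ x` are forced to retrace the orbit of `x`, so membership at level `k ≤
N` would put `τᴺ⁻ᵏ x` in the partition. -/
lemma not_mem_iterate_hatImage (h : IsPiecewiseMonotonic τ a) (hinj : IsEssentiallyInjective τ)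
    (k : ℕ) : ∀ (x : unitInterval) (N : ℕ), k ≤ N → (∀ m ≤ N, τ^[m] x ∉ range a) →
      τ^[N] x ∉ (hatImage τ)^[k] (range a) := by
  induction k with
  | zero => exact fun x N _ hN => hN N le_rfl
  | succ k ih =>
    intro x N hkN hN hmem
    obtain ⟨N, rfl⟩ : ∃ M, N = M + 1 := ⟨N - 1, by omega⟩
    rw [Function.iterate_succ_apply'] at hmem
    obtain ⟨w, hw, hwx⟩ := mem_iUnion₂.1 hmem
    rw [Function.iterate_succ_apply'] at hwx
    rw [h.eq_of_mem_oneSidedLimits hinj (hN N (Nat.le_succ N)) hwx] at hw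
    exact ih x N (by omega) (fun m hm => hN m (by omega)) hw

/-- A jump outside `B` is not at a partition point: the interior ones are in `B`, and `0` and `1`
carry no jump. So it comes from a jump of the previous function at `τ x`, which is again outside
`B`. -/
lemma jump_pullback_iterate (h : IsPiecewiseMonotonic τ a)
    (hB : range a \ {0, 1} ⊆ B) (hB' : ∀ x ∉ range a, τ x ∈ B → x ∈ B)
    (f : C(Disconnection (cuts τ a), ℤ)) (N : ℕ) : ∀ x ∉ B,
      Disconnection.jump x (h.pullback^[N] f) ≠ 0 → Disconnection.jump (τ^[N] x) f ≠ 0 ∧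
        τ^[N] x ∉ B ∧ ∀ m ≤ N, τ^[m] x ∉ range a := by
  have hxa : ∀ x ∉ B, ∀ g : C(Disconnection (cuts τ a), ℤ), Disconnection.jump x g ≠ 0 →
      x ∉ range a := by
    intro x hx g hg hxa
    have := Disconnection.mem_of_jump_ne_zero hg
    exact hx (hB ⟨hxa, by simp [this.2]⟩)
  induction N with
  | zero =>
    intro x hx hj
    refine ⟨hj, hx, fun m hm => ?_⟩
    obtain rfl : m = 0 := by omega
    exact hxa x hx _ hj
  | succ N ih =>
    intro x hx hj
    have hxa' := hxa x hx _ hj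
    rw [Function.iterate_succ_apply', Ne, h.jump_pullback_eq_zero_iff hxa'] at hj
    obtain ⟨h1, h2, h3⟩ := ih (τ x) (fun hx' => hx (hB' x hxa' hx')) hj
    refine ⟨h1, h2, fun m hm => ?_⟩
    cases m with
    | zero => exact hxa'
    | succ m => exact h3 m (by omega)

/-- Each of the finitely many jumps outside `B` sits at some level of the forward orbit of the
partition. Once `N` bounds these levels, a jump surviving outside `B` would have an orbit avoiding
the partition for too long. -/
lemma exists_pullback_iterate (h : IsPiecewiseMonotonic τ a) (hinj : IsEssentiallyInjective τ)
    (hB : range a \ {0, 1} ⊆ B) (hB' : ∀ x ∉ range a, τ x ∈ B → x ∈ B)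
    (hBf : ∀ x ∈ B, x ∉ range a → τ x ∈ B) (f : C(Disconnection (cuts τ a), ℤ)) :
    ∃ N : ℕ, ∀ x ∉ B, Disconnection.jump x (h.pullback^[N] f) = 0 := by
  have hk : ∀ y, y ∈ cuts τ a → y ∉ B → ∃ k, y ∈ (hatImage τ)^[k] (range a) := fun y hy hyB =>
    mem_iUnion.1 ((h.cuts_subset hinj hB hB' hBf hy).resolve_left hyB)
  choose! K hK using hk
  obtain ⟨N, hN⟩ := ((Disconnection.finite_jumps f).image K).bddAbove
  refine ⟨N, fun x hx => ?_⟩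
  by_contra hj
  obtain ⟨h1, h2, h3⟩ := h.jump_pullback_iterate hB hB' f N x hx hj
  exact h.not_mem_iterate_hatImage hinj _ x N (hN (mem_image_of_mem K h1)) h3
    (hK _ (Disconnection.mem_of_jump_ne_zero h1).1 h2)

end BackwardSet

/-! ### The module structure read on `C(X, ℤ)`, and the isomorphism for essentially bijective maps.
-/

lemma transfer_injective (h : IsPiecewiseMonotonic τ a) (hinj : IsEssentiallyInjective τ) :
    Function.Injective (transfer h.isPiecewiseHomeo) :=
  Function.LeftInverse.injective (h.pullback_transfer hinj)

lemma transfer_pullback (h : IsPiecewiseMonotonic τ a) (hb : IsEssentiallyBijective τ)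
    (f : C(Disconnection (cuts τ a), ℤ)) : transfer h.isPiecewiseHomeo (h.pullback f) = f := by
  obtain ⟨g, rfl⟩ := transfer_surjective h.isPiecewiseHomeo (h.localHomeo_surjective hb.surjective) f
  rw [h.pullback_transfer hb.injective]

/-- Writing `f` as the pullback of its transfer moves the jump one step along `β`. Only vanishing is
recorded, so the signs from decreasing branches play no role. -/
lemma jump_backward_eq_zero_iff (h : IsPiecewiseMonotonic τ a) (hinj : IsEssentiallyInjective τ)
    {β : ℕ → unitInterval} (hβ : ∀ k, β (k + 1) ∉ range a ∧ τ (β (k + 1)) = β k) (k : ℕ) :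
    ∀ f, Disconnection.jump (β k) f = 0 ↔
      Disconnection.jump (β 0) ((transfer h.isPiecewiseHomeo)^[k] f) = 0 := by
  induction k with
  | zero => exact fun f => Iff.rfl
  | succ k ih =>
    intro f
    conv_lhs => rw [← h.pullback_transfer hinj f]
    rw [h.jump_pullback_eq_zero_iff (hβ k).1, (hβ k).2, ih, Function.iterate_succ_apply]

theorem bijective_mk (h : IsPiecewiseMonotonic τ a) (hinj : IsEssentiallyInjective τ) :
    Function.Bijective (DG.mk h) := by
  refine ⟨(injective_iff_map_eq_zero _).2 fun f hf => ?_, QuotientAddGroup.mk'_surjective _⟩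
  obtain ⟨k, hk⟩ := (QuotientAddGroup.eq_zero_iff f).1 hf
  refine (h.transfer_injective hinj).iterate k ?_
  rw [hk, iterate_map_zero]

/-- The isomorphism of `C(X, ℤ)` with the dimension module, for essentially bijective maps. -/
noncomputable def moduleEquiv (h : IsPiecewiseMonotonic τ a) (hb : IsEssentiallyBijective τ) :
    C(Disconnection (cuts τ a), ℤ) ≃+ DimensionModule h hb.surjective :=
  AddEquiv.ofBijective (DG.mk h) (h.bijective_mk hb.injective)

open LaurentPolynomial

lemma T_one_smul_moduleEquiv (h : IsPiecewiseMonotonic τ a) (hb : IsEssentiallyBijective τ)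
    (f : C(Disconnection (cuts τ a), ℤ)) :
    (T 1 : ℤ[T;T⁻¹]) • h.moduleEquiv hb f = h.moduleEquiv hb (transfer h.isPiecewiseHomeo f) :=
  laurentModule_T_one_smul (DG.automorphism h hb.surjective) (DG.mk h f)

lemma T_smul_moduleEquiv (h : IsPiecewiseMonotonic τ a) (hb : IsEssentiallyBijective τ) (k : ℕ)
    (f : C(Disconnection (cuts τ a), ℤ)) : (T k : ℤ[T;T⁻¹]) • h.moduleEquiv hb f =
      h.moduleEquiv hb ((transfer h.isPiecewiseHomeo)^[k] f) := by
  induction k with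
  | zero => simp
  | succ k ih =>
    rw [Nat.cast_succ, add_comm, T_add, mul_smul, ih, T_one_smul_moduleEquiv,
      Function.iterate_succ_apply']

lemma T_neg_smul_moduleEquiv (h : IsPiecewiseMonotonic τ a) (hb : IsEssentiallyBijective τ) (k : ℕ)
    (f : C(Disconnection (cuts τ a), ℤ)) : (T (-k) : ℤ[T;T⁻¹]) • h.moduleEquiv hb f =
      h.moduleEquiv hb (h.pullback^[k] f) := by
  induction k with
  | zero => simp
  | succ k ih =>
    rw [show (-((k + 1 : ℕ) : ℤ)) = -1 + -k by push_cast; ring, T_add, mul_smul, ih,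
      Function.iterate_succ_apply']
    conv_lhs => rw [← h.transfer_pullback hb (h.pullback^[k] f), ← T_one_smul_moduleEquiv]
    exact T_neg_one_smul_T_one_smul _

/-- The criterion is applied with `E j` the step function at the interior partition point `c j`, `D
j` the jump there, `u` the constant `1`, and `W` the functions whose jumps all lie on the backward
orbits of the `c j`. -/
theorem nonempty_linearEquiv (h : IsPiecewiseMonotonic τ a) (hb : IsEssentiallyBijective τ)
    (hC : hatOrbit τ (hatImage τ (range a)) ∩ range a ⊆ {0, 1}) :
    Nonempty (DimensionModule h hb.surjective ≃ₗ[ℤ[T;T⁻¹]]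
      (Fin (n - 1) → ℤ[T;T⁻¹]) × TrivialInt) := by
  let c : Fin (n - 1) → unitInterval := fun j => a ⟨j + 1, by omega⟩
  have hc_inj : Function.Injective c := fun i j hij => by
    have := congrArg Fin.val (h.strictMono.injective hij)
    exact Fin.ext (by simpa using this)
  have hc0 : ∀ j, c j ≠ 0 := fun j e => by
    have := congrArg Fin.val (h.strictMono.injective (e.trans h.first.symm))
    simp at this
  have hc1 : ∀ j, c j ≠ 1 := fun j e => by
    have := congrArg Fin.val (h.strictMono.injective (e.trans h.last.symm))
    simp at this; omega
  have hc_range : range a \ {0, 1} ⊆ range c := by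
    rintro _ ⟨⟨i, rfl⟩, hi⟩
    have h0 : i ≠ 0 := fun e => hi (Or.inl (e ▸ h.first))
    have h1 : i ≠ Fin.last n := fun e => hi (Or.inr (e ▸ h.last))
    rw [Ne, Fin.ext_iff] at h0 h1
    simp only [Fin.val_zero, Fin.val_last] at h0 h1
    exact ⟨⟨i - 1, by omega⟩, congrArg a (Fin.ext (by simp; omega))⟩
  have hca : ∀ j, c j ∈ range a := fun j => mem_range_self _
  have hcS : ∀ j, c j ∈ cuts τ a ∧ c j ≠ 0 ∧ c j ≠ 1 := fun j => ⟨mem_cuts _, hc0 j, hc1 j⟩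
  have h1S : (1 : unitInterval) ∈ cuts τ a := h.last ▸ mem_cuts _
  have hex : ∀ j, ∃ β : ℕ → unitInterval, β 0 = c j ∧
      ∀ k, β (k + 1) ∉ range a ∧ τ (β (k + 1)) = β k := fun j =>
    h.exists_backward_orbit hb.surjective fun hj => by
      rcases hC ⟨hj, hca j⟩ with e | e
      · exact hc0 j e
      · exact hc1 j e
  choose β hβ0 hβ using hex
  set B : Set unitInterval := {x | ∃ j k, β j k = x} with hBdef
  have hB : range a \ {0, 1} ⊆ B := fun x hx => by
    obtain ⟨j, rfl⟩ := hc_range hx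
    exact ⟨j, 0, hβ0 j⟩
  have hB' : ∀ x ∉ range a, τ x ∈ B → x ∈ B := by
    rintro x hx ⟨j, k, e⟩
    -- Both `x` and `β j (k + 1)` map to `β j k`, and the latter is off the partition, so its
    -- uniqueness as a preimage applies.
    refine ⟨j, k + 1, h.eq_of_mem_oneSidedLimits hb.injective hx ?_⟩
    rw [h.oneSidedLimits_eq (hβ j k).1, (hβ j k).2, e]
    rfl
  have hBf : ∀ x ∈ B, x ∉ range a → τ x ∈ B := by
    rintro _ ⟨j, k, rfl⟩ hx
    cases k with
    | zero => exact absurd (hβ0 j ▸ hca j) hx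
    | succ k => exact ⟨j, k, (hβ j k).2.symm⟩
  let e := h.moduleEquiv hb
  have hjump : ∀ j k f, Disconnection.jump (β j k) f = 0 ↔
      Disconnection.jump (c j) ((transfer h.isPiecewiseHomeo)^[k] f) = 0 := fun j k f => by
    rw [h.jump_backward_eq_zero_iff hb.injective (hβ j), hβ0]
  have heD : ∀ x f, (Disconnection.jump x).comp e.symm.toAddMonoidHom (e f) =
      Disconnection.jump x f := fun x f => by
    change Disconnection.jump x (e.symm (e f)) = _
    rw [e.symm_apply_apply]
  have hWmem : ∀ f, e f ∈ (⨅ x ∈ Bᶜ, ((Disconnection.jump x).comp e.symm.toAddMonoidHom).ker) ↔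
      ∀ x ∉ B, Disconnection.jump x f = 0 := fun f => by
    simp only [AddSubgroup.mem_iInf, AddMonoidHom.mem_ker, heD, mem_compl_iff]
  refine nonempty_linearEquiv_of_functionals
    (E := fun j => e (Disconnection.step (c j) (hcS j) h1S)) (u := e 1)
    (D := fun j => (Disconnection.jump (c j)).comp e.symm.toAddMonoidHom)
    (⨅ x ∈ Bᶜ, ((Disconnection.jump x).comp e.symm.toAddMonoidHom).ker)
    ?_ ?_ ?_ ?_ ?_ ?_ ?_ ?_ ?_
  · rw [h.T_one_smul_moduleEquiv]
    congr 1
    ext x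
    obtain ⟨y, rfl⟩ := h.localHomeo_surjective hb.surjective x
    rw [transfer_apply_map h.isPiecewiseHomeo (h.localHomeo_injective hb.injective)]
    rfl
  · intro z hz
    rw [← map_zsmul, EmbeddingLike.map_eq_zero_iff] at hz
    simpa using congrArg (fun f : C(Disconnection (cuts τ a), ℤ) =>
      f (Disconnection.lift _ 0 true)) hz
  · intro j
    rw [heD, Disconnection.jump_apply]; simp
  · intro j i k
    rw [h.T_smul_moduleEquiv, heD]
    cases k with
    | zero =>
      rw [Function.iterate_zero, id, Disconnection.jump_step]
      simp [hc_inj.eq_iff]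
    | succ k =>
      -- For positive powers the jump is read at a point of the backward orbit, which is off the
      -- partition and so is not `c i`.
      rw [if_neg (by omega), ← hjump, Disconnection.jump_step, if_neg]
      exact fun e => (hβ j k).1 (e ▸ hca i)
  · intro x
    obtain ⟨f, rfl⟩ := e.surjective x
    have hfin : ∀ j, ∃ K, ∀ k, K ≤ k → Disconnection.jump (β j k) f = 0 := by
      intro j
      -- The backward orbit is infinite, so the finitely many jumps of `f` occupy only finitely many
      -- of its indices.
      have hinj : Function.Injective (β j) := backward_injective (hβ0 j ▸ hca j) (hβ j)
      obtain ⟨K, hK⟩ := ((Disconnection.finite_jumps f).preimage hinj.injOn).bddAbove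
      refine ⟨K + 1, fun k hk => ?_⟩
      by_contra hne
      have := hK (show k ∈ _ from hne)
      omega
    choose K hK using hfin
    refine ⟨Finset.univ.sup K, fun k hk j => ?_⟩
    rw [h.T_smul_moduleEquiv, heD, ← hjump]
    exact hK j k ((Finset.le_sup (Finset.mem_univ j)).trans hk)
  · intro i
    rw [hWmem]
    intro x hx
    rw [Disconnection.jump_step, if_neg]
    rintro rfl
    exact hx ⟨i, 0, hβ0 i⟩
  · intro x hx
    obtain ⟨f, rfl⟩ := e.surjective x
    rw [hWmem] at hx
    have := h.T_neg_smul_moduleEquiv hb 1 f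
    rw [Nat.cast_one] at this
    rw [this, hWmem]
    intro x hxB
    by_contra hj
    obtain ⟨h1, h2, -⟩ := h.jump_pullback_iterate hB hB' f 1 x hxB hj
    exact h1 (hx _ h2)
  · intro x
    obtain ⟨f, rfl⟩ := e.surjective x
    obtain ⟨N, hN⟩ := h.exists_pullback_iterate hb.injective hB hB' hBf f
    exact ⟨N, by rw [h.T_neg_smul_moduleEquiv, hWmem]; exact hN⟩
  · intro x hx hk
    obtain ⟨f, rfl⟩ := e.surjective x
    rw [hWmem] at hx
    -- Jumps on `B` vanish by the functionals and jumps off `B` by membership in `W`, so `f` is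
    -- constant.
    obtain ⟨z, hz⟩ := Disconnection.eq_const_of_jump_eq_zero f fun x => by
      by_cases hxB : x ∈ B
      · obtain ⟨j, k, rfl⟩ := hxB
        rw [hjump, ← heD, ← h.T_smul_moduleEquiv]
        exact hk j k
      · exact hx x hxB
    refine ⟨z, ?_⟩
    rw [← map_zsmul]
    congr 1
    ext p
    simp [hz]

lemma eq_endpoint (h : IsPiecewiseMonotonic τ a) {x : unitInterval} (hx : x ∈ range a) {i : Fin n}
    (hi : x ∈ Icc (a i.castSucc) (a i.succ)) : x = a i.castSucc ∨ x = a i.succ := by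
  obtain ⟨l, rfl⟩ := hx
  have h1 := h.strictMono.le_iff_le.1 hi.1
  have h2 := h.strictMono.le_iff_le.1 hi.2
  rw [Fin.le_def] at h1 h2
  simp only [Fin.val_castSucc, Fin.val_succ] at h1 h2
  have : (l : ℕ) = i ∨ (l : ℕ) = i + 1 := by omega
  exact this.imp (fun e => congrArg a (Fin.ext e)) fun e => congrArg a (Fin.ext e)

end IsPiecewiseMonotonic

/-! ### Generalized interval exchange maps. -/

namespace IsGeneralizedIntervalExchange

open IsPiecewiseMonotonic

variable {n : ℕ} {τ : unitInterval → unitInterval} {a : Fin (n + 1) → unitInterval}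

lemma lo_eq_branch (g : IsGeneralizedIntervalExchange τ a) (i : Fin n) :
    lo τ a i = branch τ a i (a i.castSucc) := by
  simp [lo, IsPiecewiseMonotonic.flip, g.increasing i]

lemma hi_eq_branch (g : IsGeneralizedIntervalExchange τ a) (i : Fin n) :
    hi τ a i = branch τ a i (a i.succ) := by
  simp [hi, IsPiecewiseMonotonic.flip, g.increasing i]

lemma castSucc_lt_one (g : IsGeneralizedIntervalExchange τ a) (i : Fin n) : a i.castSucc < 1 :=
  (g.lt i).trans_le unitInterval.le_one'

lemma lo_eq (g : IsGeneralizedIntervalExchange τ a) (i : Fin n) :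
    lo τ a i = τ (a i.castSucc) := by
  rw [g.lo_eq_branch]
  have : (𝓝[>] (a i.castSucc)).NeBot := nhdsGT_neBot_of_exists_gt ⟨_, g.lt i⟩
  exact tendsto_nhds_unique (g.tendsto_nhdsGT i ⟨le_rfl, g.lt i⟩)
    ((g.right_continuous _ (g.castSucc_lt_one i)).mono_left (nhdsWithin_mono _ Ioi_subset_Ici_self))

/-- The finite union of closed images is closed and contains `[0,1)`, which is dense. -/
lemma mem_Icc_lo_hi (g : IsGeneralizedIntervalExchange τ a) (y : unitInterval) :
    ∃ i, y ∈ Icc (lo τ a i) (hi τ a i) := by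
  have hcl : IsClosed (⋃ i, Icc (lo τ a i) (hi τ a i)) :=
    isClosed_iUnion_of_finite fun _ => isClosed_Icc
  have hsub : Iio (1 : unitInterval) ⊆ ⋃ i, Icc (lo τ a i) (hi τ a i) := by
    intro y hy
    obtain ⟨x, hx, rfl⟩ := g.bijOn.surjOn hy
    obtain ⟨i, hi⟩ := g.exists_mem_Ico (ne_of_lt hx)
    refine mem_iUnion.2 ⟨i, ?_⟩
    rcases eq_or_lt_of_le hi.1 with rfl | h1
    · rw [← g.lo_eq]
      exact ⟨le_rfl, (g.lo_lt_hi i).le⟩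
    · exact Ioo_subset_Icc_self (g.image_Ioo i ▸ mem_image_of_mem τ ⟨h1, hi.2⟩)
  have := closure_minimal hsub hcl
  rw [closure_Iio' ⟨0, zero_lt_one⟩] at this
  exact mem_iUnion.1 (this unitInterval.le_one')

/-- Injectivity on `[0,1)` leaves `1` as the only point of `J'` that can share its value with a
point of `J` below `1`. Two such points of `J` would then both have the value `τ 1`. -/
theorem isEssentiallyBijective (g : IsGeneralizedIntervalExchange τ a) :
    IsEssentiallyBijective τ where
  surjective := by
    refine eq_univ_of_forall fun y => ?_
    obtain ⟨i, hi⟩ := g.mem_Icc_lo_hi y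
    rw [← g.image_branch_Icc] at hi
    obtain ⟨x, hx, rfl⟩ := hi
    exact mem_iUnion₂.2 ⟨x, mem_univ _, g.branch_mem i hx⟩
  injective := by
    rintro ⟨J, J', hJ, hJn, -, -, hd, he⟩
    have key : ∀ x ∈ J, x < 1 → (1 : unitInterval) ∈ J' ∧ τ x = τ 1 := by
      intro x hx hx1
      obtain ⟨x', hx', e⟩ : τ x ∈ τ '' J' := he ▸ mem_image_of_mem τ hx
      rcases eq_or_lt_of_le (unitInterval.le_one' : x' ≤ 1) with rfl | h1
      · exact ⟨hx', e.symm⟩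
      · exact absurd (g.bijOn.injOn h1 hx1 e) fun e' => disjoint_left.1 hd hx (e' ▸ hx')
    obtain ⟨x, hx, y, hy, hxy⟩ := hJn.exists_lt
    obtain ⟨z, hxz, hzy⟩ := exists_between hxy
    have hz1 : z < 1 := hzy.trans_le unitInterval.le_one'
    have h1 := key x hx (hxz.trans hz1)
    have h2 := key z (hJ.out hx hy ⟨hxz.le, hzy.le⟩) hz1
    exact hxz.ne (g.bijOn.injOn (hxz.trans hz1) hz1 (h1.2.trans h2.2.symm))

/-- A right endpoint below `1` is a value of `τ` on `[0,1)`. It is not attained inside a piece,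
since the image of that piece would overlap the `i`-th image, so it is attained at a left endpoint.
-/
lemma hi_eq (g : IsGeneralizedIntervalExchange τ a) (i : Fin n) :
    hi τ a i = 1 ∨ ∃ j, hi τ a i = lo τ a j := by
  rcases eq_or_lt_of_le (unitInterval.le_one' : hi τ a i ≤ 1) with h1 | h1
  · exact Or.inl h1
  obtain ⟨x, hx, e⟩ := g.bijOn.surjOn h1
  obtain ⟨j, hj⟩ := g.exists_mem_Ico (ne_of_lt hx)
  rcases eq_or_lt_of_le hj.1 with rfl | h2
  · exact Or.inr ⟨j, by rw [← e, g.lo_eq]⟩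
  · exfalso
    have h3 : hi τ a i ∈ Ioo (lo τ a j) (hi τ a j) := by
      rw [← g.image_Ioo j, ← e]; exact mem_image_of_mem τ ⟨h2, hj.2⟩
    by_cases hij : i = j
    · subst hij; exact lt_irrefl _ h3.2
    have hd := g.disjoint_images g.isEssentiallyBijective.injective hij
    rw [disjoint_iff_inter_eq_empty, Ioo_inter_Ioo, Ioo_eq_empty_iff] at hd
    refine hd ?_
    rw [sup_lt_iff, lt_inf_iff, lt_inf_iff]
    exact ⟨⟨g.lo_lt_hi i, (g.lo_lt_hi i).trans h3.2⟩, h3.1, g.lo_lt_hi j⟩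

/-- The value `0` is attained on `[0,1)`, but not inside a piece, because the image of an open piece
is an open interval with left endpoint at least `0`. -/
lemma exists_map_eq_zero (g : IsGeneralizedIntervalExchange τ a) :
    ∃ j : Fin n, τ (a j.castSucc) = 0 := by
  obtain ⟨x, hx, e⟩ := g.bijOn.surjOn (show (0 : unitInterval) ∈ Iio 1 from mem_Iio.2 zero_lt_one)
  obtain ⟨j, hj⟩ := g.exists_mem_Ico (ne_of_lt hx)
  rcases eq_or_lt_of_le hj.1 with rfl | h2
  · exact ⟨j, e⟩
  · exfalso
    have h3 : τ x ∈ Ioo (lo τ a j) (hi τ a j) := by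
      rw [← g.image_Ioo j]; exact mem_image_of_mem τ ⟨h2, hj.2⟩
    exact (unitInterval.nonneg'.trans_lt h3.1).ne' e

/-- The points `0`, `1`, and `τᵏ(b)` for `k ≥ 1` and `b` an interior point of the partition. -/
def forwardPoints (τ : unitInterval → unitInterval) (a : Fin (n + 1) → unitInterval) :
    Set unitInterval :=
  {0, 1} ∪ {x | ∃ b ∈ range a \ {0, 1}, ∃ k : ℕ, τ^[k + 1] b = x}

lemma lo_mem_forwardPoints (g : IsGeneralizedIntervalExchange τ a) (i : Fin n) :
    lo τ a i ∈ forwardPoints τ a := by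
  have hint : ∀ j : Fin n, a j.castSucc ≠ 0 → a j.castSucc ∈ range a \ {0, 1} := fun j h0 =>
    ⟨mem_range_self _, by simp [h0, (g.castSucc_lt_one j).ne]⟩
  rw [g.lo_eq]
  by_cases h0 : a i.castSucc = 0
  · obtain ⟨j, hj⟩ := g.exists_map_eq_zero
    by_cases hj0 : a j.castSucc = 0
    · rw [h0, ← hj0, hj]; exact Or.inl (Or.inl rfl)
    -- The point `0` is not an interior partition point, but here it is the image of one, so `τ 0`
    -- is a second iterate.
    · exact Or.inr ⟨_, hint j hj0, 1, by rw [h0]; exact congrArg τ hj⟩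
  · exact Or.inr ⟨_, hint i h0, 0, rfl⟩

lemma hi_mem_forwardPoints (g : IsGeneralizedIntervalExchange τ a) (i : Fin n) :
    hi τ a i ∈ forwardPoints τ a := by
  rcases g.hi_eq i with e | ⟨j, e⟩
  · exact Or.inl (Or.inr e)
  · exact e ▸ g.lo_mem_forwardPoints j

lemma hatImage_range_subset (g : IsGeneralizedIntervalExchange τ a) :
    hatImage τ (range a) ⊆ forwardPoints τ a := by
  intro y hy
  obtain ⟨x, hx, hxy⟩ := mem_iUnion₂.1 hy
  obtain ⟨i, hi, rfl⟩ := g.exists_branch_eq hxy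
  rcases g.eq_endpoint hx hi with e | e
  · rw [e, ← g.lo_eq_branch]; exact g.lo_mem_forwardPoints i
  · rw [e, ← g.hi_eq_branch]; exact g.hi_mem_forwardPoints i

lemma hatImage_forwardPoints_subset (g : IsGeneralizedIntervalExchange τ a) :
    hatImage τ (forwardPoints τ a) ⊆ forwardPoints τ a := by
  intro y hy
  obtain ⟨x, hx, hxy⟩ := mem_iUnion₂.1 hy
  by_cases hxa : x ∈ range a
  · exact g.hatImage_range_subset (mem_iUnion₂.2 ⟨x, hxa, hxy⟩)
  rw [g.oneSidedLimits_eq hxa] at hxy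
  obtain rfl := mem_singleton_iff.1 hxy
  rcases hx with (rfl | rfl) | ⟨b, hb, k, rfl⟩
  · exact absurd ⟨_, g.first⟩ hxa
  · exact absurd ⟨_, g.last⟩ hxa
  · exact Or.inr ⟨b, hb, k + 1, Function.iterate_succ_apply' _ _ _⟩

/-- The set `forwardPoints τ a` contains the limits at the partition and is closed under `τ̂`. An
interior partition point in it other than `0` and `1` would be a positive iterate of an interior
partition point, contrary to `ho`. -/
theorem hatOrbit_inter_subset (g : IsGeneralizedIntervalExchange τ a)
    (ho : InfiniteDisjointOrbits τ (range a \ {0, 1})) :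
    hatOrbit τ (hatImage τ (range a)) ∩ range a ⊆ {0, 1} := by
  have hsub : ∀ k, (hatImage τ)^[k] (hatImage τ (range a)) ⊆ forwardPoints τ a := by
    intro k
    induction k with
    | zero => exact g.hatImage_range_subset
    | succ k ih =>
      rw [Function.iterate_succ_apply']
      exact (biUnion_subset_biUnion_left ih).trans g.hatImage_forwardPoints_subset
  rintro x ⟨hx, hxa⟩
  obtain ⟨k, hk⟩ := mem_iUnion.1 hx
  rcases hsub k hk with h01 | ⟨b, hb, l, rfl⟩
  · exact h01
  · by_contra hne
    have := (ho b hb _ ⟨hxa, hne⟩ (l + 1) 0 rfl).2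
    omega

end IsGeneralizedIntervalExchange

theorem proposition1p103 {n : ℕ} {τ : unitInterval → unitInterval}
    {a : Fin (n + 1) → unitInterval} (h : IsPiecewiseMonotonic τ a) :
    (∀ hb : IsEssentiallyBijective τ,
      hatOrbit τ (hatImage τ (range a)) ∩ range a ⊆ {0, 1} →
        Nonempty (DimensionModule h hb.surjective ≃ₗ[ℤ[T;T⁻¹]]
          (Fin (n - 1) → ℤ[T;T⁻¹]) × TrivialInt)) ∧
    (IsGeneralizedIntervalExchange τ a → InfiniteDisjointOrbits τ (range a \ {0, 1}) →
      ∃ hb : IsEssentiallyBijective τ, Function.Bijective (DG.mk h) ∧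
        Nonempty (DimensionModule h hb.surjective ≃ₗ[ℤ[T;T⁻¹]]
          (Fin (n - 1) → ℤ[T;T⁻¹]) × TrivialInt)) := by
  refine ⟨fun hb hC => h.nonempty_linearEquiv hb hC, fun g ho => ?_⟩
  have hb := g.isEssentiallyBijective
  exact ⟨hb, h.bijective_mk hb.injective, h.nonempty_linearEquiv hb (g.hatOrbit_inter_subset ho)⟩
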